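/- **Proposition.** Every multi-agent system that is expressible in UHAT and computes PARITY has $\mathrm{Size}(N)\in\Omega(N)$: for each such system there are $c>0$ and $N_0$ with $\mathrm{Size}(N)\ge cN$ for all $N\ge N_0$. The notions are as follows. *Transformers.* A UHAT (unique hard attention Transformer) is a causally masked decoder-only Transformer with token embeddings, arbitrary positional embeddings in $\mathbb R^d$ and a finite context window. The embedding of a string is the matrix $X$ whose $i$-th row is the sum of the $i$-th token's embedding and the $i$-th positional embedding. A layer with $H$ heads maps $X\in\mathbb R^{n\times d}$ to $\psi\big([\mathrm{Att}_1(X),\dots,\mathrm{Att}_H(X)]W_O\big)$ with $\mathrm{Att}_h(X)=\mathrm{UHAT}\big(XW_Q^{h}(W_K^{h})^{\top}X^{\top}\big)XW_V^{h}$, where $\psi:\mathbb R^d\to\mathbb R^d$ (an arbitrary function) is applied to each row, and row $i$ of $\mathrm{UHAT}(A)$ is $1$ at the position $j\le i$ maximizing $A_{i,j}$ (the rightmost one in case of a tie) and $0$ elsewhere. The next token is a function of the last row of the last layer. The width $d$, the head dimension, the context window and all parameters are arbitrary. *Multi-agent systems.* Inputs are $x\in\{0,1\}^N$, $N\ge1$;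 the chain-of-thought (CoT) alphabet $\Xi\supseteq\{0,1\}$ is an arbitrary set. A system fixes for each $N$ a number of agents $w=w(N)\in\{1,\dots,N\}$ and a manager agent, and assigns to each $x\in\{0,1\}^N$ a labelled graph. Agent $i$ has nodes $T_i^{(1)},\dots,T_i^{(D_i)}$ (the numbers $D_i\ge 0$ may depend on $x$). Edges are CoT edges $T_i^{(t)}\to T_i^{(t+1)}$ and communication edges $T_i^{(t)}\to T_j^{(t+1)}$, $j\ne i$, labelled by elements of $\Xi$. Every node $T_i^{(t)}$ with $t>1$ has exactly one incoming edge; each node has either no outgoing edge, or one outgoing edge, or communication edges with one common label to all other agents. $\mathrm{Size}(N)$ is the maximal number of nodes over all inputs of length $N$. The system computes PARITY if, for every $x$ with $|x|\ge 1$, the last CoT edge of the manager is labelled $\sum_k x_k \bmod 2$. *Expressibility.* Agent $i$ processes the string $\xi(i)$ that consists of its chunk of the input (the positions $\lceil N(i-1)/w\rceil+1,\dots,\lceil Ni/w\rceil$), the token $\mathsf{ID}_i$, then for $t=1,\dots,D_i$ the token $\mathsf{RECEIVE}\_\sigma$ if $T_i^{(t)}$ has an incoming communication edge labelled $\sigma$,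 followed by the token $\sigma$, $\mathsf{SEND}\_\sigma\_\mathsf{ID}_j$ or $\mathsf{BROADCAST}\_\sigma$ according to the outgoing edges of $T_i^{(t)}$, if any, and finally $\mathsf{EOS}$. The token *generated* by a Transformer $T$ for agent $i$ at time $t$ is its next token on the prefix of $\xi(i)$ that ends just before the token for the outgoing edges of $T_i^{(t)}$ (for $t>D_i$: just before $\mathsf{EOS}$). $T$ runs the system on inputs of length $N$ if 1. for all $x\in\{0,1\}^N$, every $\xi(i)$ fits into the context window, and all tokens of $\xi(i)$ arising from outgoing edges, and $\mathsf{EOS}$, are the tokens generated by $T$; 2. the graph depends on the input only through the generated tokens: if on $x,y\in\{0,1\}^N$ all agents generate the same tokens at all times $\le t$, then the two graphs have the same outgoing edges at times $\le t$ and the same nodes at times $\le t+1$. (So a generated token can be overridden by an incoming message, but which ones are overridden is decided by the tokens generated so far.) The system is expressible in UHAT if there are $H,L$ such that for every $n$ some UHAT with at most $H$ heads per layer and at most $L$ layers runs the system on all input lengths $1\le N\le n$. -/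

import Mathlib

open Asymptotics Filter

namespace MAS

/-! ### Unique hard attention Transformers -/

/-- The causally masked unique-hard-attention matrix: row `i` has its only `1` at the position
`j ≤ i` maximising the score `A i j`, the rightmost one in case of a tie. -/
noncomputable def uhat {n : ℕ} (A : Matrix (Fin n) (Fin n) ℝ) : Matrix (Fin n) (Fin n) ℝ :=
  open Classical in
  Matrix.of fun i j =>
    if j ≤ i ∧ (∀ k, k ≤ i → A i k ≤ A i j) ∧ (∀ k, k ≤ i → j < k → A i k < A i j)
    then 1 else 0

/-- Parameters of one layer: model dimension `d`, head dimension `m`, `H` heads. The function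
`mlp` computed by the feed-forward block may be any function. -/
structure Layer (d m H : ℕ) where
  WQ : Fin H → Matrix (Fin d) (Fin m) ℝ
  WK : Fin H → Matrix (Fin d) (Fin m) ℝ
  WV : Fin H → Matrix (Fin d) (Fin m) ℝ
  WO : Matrix (Fin H × Fin m) (Fin d) ℝ
  mlp : (Fin d → ℝ) → (Fin d → ℝ)

/-- One attention head: `UHAT(X W_Q W_Kᵀ Xᵀ) X W_V`. -/
noncomputable def Layer.head {d m H n : ℕ} (ℓ : Layer d m H) (h : Fin H)
    (X : Matrix (Fin n) (Fin d) ℝ) : Matrix (Fin n) (Fin m) ℝ :=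
  uhat (X * ℓ.WQ h * (ℓ.WK h).transpose * X.transpose) * X * ℓ.WV h

/-- Concatenated heads multiplied by `W_O`. -/
noncomputable def Layer.multiHead {d m H n : ℕ} (ℓ : Layer d m H)
    (X : Matrix (Fin n) (Fin d) ℝ) : Matrix (Fin n) (Fin d) ℝ :=
  (Matrix.of fun i (p : Fin H × Fin m) => ℓ.head p.1 X i p.2) * ℓ.WO

/-- The layer output: the MLP is applied to every row of the attention output. -/
noncomputable def Layer.apply {d m H n : ℕ} (ℓ : Layer d m H)
    (X : Matrix (Fin n) (Fin d) ℝ) : Matrix (Fin n) (Fin d) ℝ :=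
  Matrix.of fun i => ℓ.mlp (ℓ.multiHead X i)

/-- A decoder-only UHAT Transformer over the vocabulary `V`, with arbitrary positional embeddings
and context window `ctx`. The values of `posEmb` from `ctx` on are never used. The next token is
read off the last row of the last layer by `decode`, which may be any function (such as the
`argmax` of an output matrix). -/
structure UHAT (V : Type*) where
  dim : ℕ
  headDim : ℕ
  heads : ℕ
  ctx : ℕ
  tokEmb : V → Fin dim → ℝ
  posEmb : ℕ → Fin dim → ℝ
  layers : List (Layer dim headDim heads)
  decode : (Fin dim → ℝ) → V

/-- Number of layers. -/
def UHAT.depth {V : Type*} (T : UHAT V) : ℕ := T.layers.length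

/-- Token embeddings plus positional embeddings. -/
noncomputable def UHAT.embed {V : Type*} (T : UHAT V) (s : List V) :
    Matrix (Fin s.length) (Fin T.dim) ℝ :=
  Matrix.of fun i => T.tokEmb (s.get i) + T.posEmb i

/-- Activations after the last layer. -/
noncomputable def UHAT.final {V : Type*} (T : UHAT V) (s : List V) :
    Matrix (Fin s.length) (Fin T.dim) ℝ :=
  T.layers.foldl (fun X ℓ => ℓ.apply X) (T.embed s)

/-- The token generated after the prompt `s` (used only for nonempty `s`). -/
noncomputable def UHAT.next {V : Type*} (T : UHAT V) (s : List V) : V :=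
  T.decode fun k => if h : s.length - 1 < s.length then T.final s ⟨s.length - 1, h⟩ k else 0

/-! ### Multi-agent systems -/

/-- Tokens read and written by the agents; `Ξ` is the CoT alphabet. -/
inductive Token (Ξ : Type*) where
  | sym (σ : Ξ)
  | agentId (i : ℕ)
  | receive (σ : Ξ)
  | send (σ : Ξ) (j : ℕ)
  | broadcast (σ : Ξ)
  | eos

/-- The outgoing edges of a node of a `w`-agent graph: none, one CoT edge, one communication edge,
or communication edges with the same label to every other agent. -/
inductive Emission (Ξ : Type*) (w : ℕ) where
  | silent
  | cot (σ : Ξ)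
  | send (σ : Ξ) (j : Fin w)
  | broadcast (σ : Ξ)

/-- Edge labels: `comm σ` for `{c, σ}` and `cot σ` for `{a, σ}`. -/
inductive EdgeLabel (Ξ : Type*) where
  | comm (σ : Ξ)
  | cot (σ : Ξ)

/-- The edge, if any, from a node of agent `i` with emission `e` to the next node of agent `j`. -/
def Emission.edge {Ξ : Type*} {w : ℕ} (i : Fin w) (e : Emission Ξ w) (j : Fin w) :
    Option (EdgeLabel Ξ) :=
  match e with
  | .silent => none
  | .cot σ => if j = i then some (.cot σ) else none
  | .send σ k => if j = k ∧ j ≠ i then some (.comm σ) else none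
  | .broadcast σ => if j ≠ i then some (.comm σ) else none

/-- The token that is written when the emission takes place. -/
def Emission.token? {Ξ : Type*} {w : ℕ} : Emission Ξ w → Option (Token Ξ)
  | .silent => none
  | .cot σ => some (.sym σ)
  | .send σ j => some (.send σ j)
  | .broadcast σ => some (.broadcast σ)

/-- The labelled DAG on one input. Agents and times are counted from `0`: agent `i` has the nodes
`(i, t)` for `t < len i`, and every edge leads from a node `(i, t)` to a node `(j, t + 1)`. -/
structure AgentGraph (Ξ : Type*) (w : ℕ) where
  len : Fin w → ℕ
  emit : Fin w → ℕ → Emission Ξ w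
  /-- Only nodes have outgoing edges. -/
  emit_of_le : ∀ i t, len i ≤ t → emit i t = .silent
  /-- A message to a single agent goes to a different agent. -/
  send_ne : ∀ i t σ j, emit i t = .send σ j → j ≠ i
  /-- Edges end in nodes. -/
  edge_lt : ∀ i t j, ((emit i t).edge i j).isSome → t + 1 < len j
  /-- Every node that is not the first one of its agent has exactly one incoming edge. -/
  existsUnique_edge : ∀ j t, t + 1 < len j → ∃! i, ((emit i t).edge i j).isSome

namespace AgentGraph

variable {Ξ : Type*} {w : ℕ}

/-- The label of the incoming edge of the node `(j, t)`, if there is one. -/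
def incoming (G : AgentGraph Ξ w) (j : Fin w) : ℕ → Option (EdgeLabel Ξ)
  | 0 => none
  | t + 1 => (List.finRange w).findSome? fun i => (G.emit i t).edge i j

/-- The token appended when the node `(j, t)` receives a message. -/
def receiveTokens (G : AgentGraph Ξ w) (j : Fin w) (t : ℕ) : List (Token Ξ) :=
  match G.incoming j t with
  | some (.comm σ) => [.receive σ]
  | _ => []

/-- All tokens contributed by the node `(i, t)`. -/
def nodeTokens (G : AgentGraph Ξ w) (i : Fin w) (t : ℕ) : List (Token Ξ) :=
  G.receiveTokens i t ++ (G.emit i t).token?.toList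

/-- Size: the number of nodes. -/
def size (G : AgentGraph Ξ w) : ℕ := ∑ i, G.len i

/-- The last CoT edge of agent `i` has the label `σ`. -/
def LastCoT (G : AgentGraph Ξ w) (i : Fin w) (σ : Ξ) : Prop :=
  ∃ t, G.emit i t = .cot σ ∧ ∀ s, t < s → ∀ τ, G.emit i s ≠ .cot τ

end AgentGraph

/-- A multi-agent system with input alphabet `α ⊆ Ξ`. The number of agents and the manager are
determined by the input length. -/
structure MultiAgentSystem (α Ξ : Type*) where
  incl : α ↪ Ξ
  width : ℕ → ℕ
  width_pos : ∀ n, 0 < width n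
  width_le : ∀ n, 0 < n → width n ≤ n
  manager : ∀ n, Fin (width n)
  graph : ∀ {n : ℕ}, (Fin n → α) → AgentGraph Ξ (width n)

namespace MultiAgentSystem

variable {α Ξ : Type*}

/-- `Size(N)`: the maximal number of nodes on an input of length `N`. -/
def size [Fintype α] (A : MultiAgentSystem α Ξ) (N : ℕ) : ℕ :=
  Finset.univ.sup fun x : Fin N → α => (A.graph x).size

/-- The system computes `f`: on every nonempty input, the last CoT edge of the manager is labelled
with the value of `f`. -/
def Computes (A : MultiAgentSystem α Ξ) (f : ∀ {n : ℕ}, (Fin n → α) → α) : Prop :=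
  ∀ n, 0 < n → ∀ x : Fin n → α, (A.graph x).LastCoT (A.manager n) (A.incl (f x))

/-- The chunk of agent `i` (counted from `0`): the positions from `⌈n i / w⌉` (inclusive) to
`⌈n (i + 1) / w⌉` (exclusive), positions being counted from `0`. -/
def chunk (A : MultiAgentSystem α Ξ) {n : ℕ} (x : Fin n → α) (i : Fin (A.width n)) : List α :=
  ((List.ofFn x).take (n * (i + 1) ⌈/⌉ A.width n)).drop (n * i ⌈/⌉ A.width n)

/-- The context from which agent `i` generates its output at time `t`: its chunk, its identifier,
the tokens of its earlier nodes, and the message, if any, received at time `t`. -/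
def prompt (A : MultiAgentSystem α Ξ) {n : ℕ} (x : Fin n → α) (i : Fin (A.width n)) (t : ℕ) :
    List (Token Ξ) :=
  (A.chunk x i).map (fun a => .sym (A.incl a)) ++ [.agentId i]
    ++ (List.range t).flatMap ((A.graph x).nodeTokens i) ++ (A.graph x).receiveTokens i t

/-- The complete string `ξ(i)` processed by agent `i`. -/
def agentString (A : MultiAgentSystem α Ξ) {n : ℕ} (x : Fin n → α) (i : Fin (A.width n)) :
    List (Token Ξ) :=
  (A.chunk x i).map (fun a => .sym (A.incl a)) ++ [.agentId i]
    ++ (List.range ((A.graph x).len i)).flatMap ((A.graph x).nodeTokens i) ++ [.eos]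

/-- `T` implements the system on `x`: every string `ξ(i)` fits into the context window, and `T`
generates every token of `ξ(i)` that stems from outgoing edges, as well as the final `eos`. -/
def Implements (A : MultiAgentSystem α Ξ) (T : UHAT (Token Ξ)) {n : ℕ} (x : Fin n → α) : Prop :=
  ∀ i : Fin (A.width n),
    (A.agentString x i).length ≤ T.ctx ∧
    (∀ t v, ((A.graph x).emit i t).token? = some v → T.next (A.prompt x i t) = v) ∧
    T.next (A.prompt x i ((A.graph x).len i)) = .eos

/-- On inputs of length `n` the graph is computed by `T`: if, up to time `t`, the agents generate
the same tokens on `x` and on `y`, then the edges leaving the nodes up to time `t` are the same, and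
so are the nodes up to time `t + 1`. In particular, which generated tokens are overridden by
incoming messages depends on the input only through the tokens generated so far. -/
def DrivenBy (A : MultiAgentSystem α Ξ) (T : UHAT (Token Ξ)) (n : ℕ) : Prop :=
  ∀ (x y : Fin n → α) (t : ℕ),
    (∀ s ≤ t, ∀ i, T.next (A.prompt x i s) = T.next (A.prompt y i s)) →
    ∀ i, (∀ s ≤ t, (A.graph x).emit i s = (A.graph y).emit i s) ∧
      (∀ s ≤ t + 1, s < (A.graph x).len i ↔ s < (A.graph y).len i)

/-- The system is expressible in UHAT: for every `n` there is a Transformer `T` running it on all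
nonempty inputs of length at most `n`, with uniformly bounded numbers of heads and layers. -/
def Expressible (A : MultiAgentSystem α Ξ) : Prop :=
  ∃ H L : ℕ, ∀ n : ℕ, ∃ T : UHAT (Token Ξ), T.heads ≤ H ∧ T.depth ≤ L ∧
    ∀ m, 0 < m → m ≤ n → (∀ x : Fin m → α, A.Implements T x) ∧ A.DrivenBy T m

end MultiAgentSystem

/-- PARITY: is the number of ones odd? -/
def parity {n : ℕ} (x : Fin n → Bool) : Bool :=
  decide (Odd (Finset.univ.filter fun k => x k = true).card)

end MAS

open MAS

/-! The system is followed in time on a shrinking subcube of inputs on which all tokens generated so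
far are constant. By `DrivenBy` the graph built so far is constant there too, and making the next
token of an agent constant costs boundedly many input bits. Flipping a free bit flips the parity, so
no bit is free once all nodes are settled; hence the number of bits is at most a constant times the
number of nodes (`card_free_le_size`).

If chunks are short, a node is settled by fixing the whole chunk of its agent
(`le_size_of_chunkLen_le`). If they are long on average, the weakness of hard attention is used
(`le_size_of_width_le`). Fixing at most half of the bits makes all activations at chunk positions,
on all layers, depend on boundedly many bits (`exists_refines_junta_runLayers`). After that a new
token is cheap: a head with a constant query always selects the row with the best key possible on
the subcube, once the few bits producing this key are fixed (`HardLayer.exists_fix_attend`).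

The restriction for one layer (`HardLayer.exists_refines_junta_step`) is greedy. A query is a
position, a possible value of its row and a head; a candidate is a position with a possible value. A
query with few candidates has a junta as its answer. If many queries have many candidates, double
counting gives one candidate that ranks high for many of them; fixing the few bits that make it
occur leaves each of these queries only the few positions that can rank at least as high. The few
remaining queries are made constant one by one. -/

namespace MAS

/-! ### Subcubes of the Boolean cube and juntas -/

/-- A subcube of `ι → Bool`: the coordinates outside `free` are fixed to those of `base`. -/
structure Subcube (ι : Type*) where
  free : Finset ι
  base : ι → Bool

namespace Subcube

variable {ι : Type*}

/-- The points of a subcube. -/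
def points (C : Subcube ι) : Set (ι → Bool) := {x | ∀ k, k ∉ C.free → x k = C.base k}

/-- `C'` arises from `C` by fixing at most `c` further coordinates. -/
def Refines (C' C : Subcube ι) (c : ℕ) : Prop :=
  C'.points ⊆ C.points ∧ C.free.card ≤ C'.free.card + c

lemma base_mem (C : Subcube ι) : C.base ∈ C.points := fun _ _ => rfl

lemma Refines.refl (C : Subcube ι) (c : ℕ) : C.Refines C c := ⟨subset_rfl, by omega⟩

lemma Refines.trans {C C' C'' : Subcube ι} {c c' : ℕ} (h : C''.Refines C' c')
    (h' : C'.Refines C c) : C''.Refines C (c + c') :=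
  ⟨h.1.trans h'.1, by have := h.2; have := h'.2; omega⟩

lemma Refines.mono {C C' : Subcube ι} {c c' : ℕ} (h : C'.Refines C c) (hc : c ≤ c') :
    C'.Refines C c' :=
  ⟨h.1, by have := h.2; omega⟩

/-- The subcube of the points that agree with `x` on `S`. -/
def fix [DecidableEq ι] (C : Subcube ι) (S : Finset ι) (x : ι → Bool) : Subcube ι :=
  ⟨C.free \ S, x⟩

lemma fix_refines [DecidableEq ι] {C : Subcube ι} {x : ι → Bool} (hx : x ∈ C.points)
    (S : Finset ι) : (C.fix S x).Refines C S.card := by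
  refine ⟨fun y hy k hk => ?_, ?_⟩
  · rw [← hx k hk]
    exact hy k fun h => hk (Finset.mem_sdiff.1 h).1
  · have := Finset.card_le_card_sdiff_add_card (s := C.free) (t := S)
    simpa [fix] using this

lemma eq_of_mem_fix [DecidableEq ι] {C : Subcube ι} {S : Finset ι} {x y : ι → Bool}
    (hy : y ∈ (C.fix S x).points) {k : ι} (hk : k ∈ S) : y k = x k :=
  hy k fun h => (Finset.mem_sdiff.1 h).2 hk

end Subcube

section Junta

variable {ι β : Type*}

/-- On `C`, the function `f` depends only on the coordinates in `S`. -/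
def DependsOnlyOn (C : Set (ι → Bool)) (f : (ι → Bool) → β) (S : Finset ι) : Prop :=
  ∀ x ∈ C, ∀ y ∈ C, (∀ k ∈ S, x k = y k) → f x = f y

/-- On `C`, the function `f` depends on at most `c` coordinates. -/
def Junta (C : Set (ι → Bool)) (c : ℕ) (f : (ι → Bool) → β) : Prop :=
  ∃ S : Finset ι, S.card ≤ c ∧ DependsOnlyOn C f S

/-- The function `f` is constant on `C`. -/
def ConstOn (C : Set (ι → Bool)) (f : (ι → Bool) → β) : Prop :=
  ∀ x ∈ C, ∀ y ∈ C, f x = f y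

lemma DependsOnlyOn.mono {C C' : Set (ι → Bool)} {f : (ι → Bool) → β} {S S' : Finset ι}
    (h : DependsOnlyOn C f S) (hC : C' ⊆ C) (hS : S ⊆ S') : DependsOnlyOn C' f S' :=
  fun x hx y hy hxy => h x (hC hx) y (hC hy) fun k hk => hxy k (hS hk)

lemma Junta.mono {C C' : Set (ι → Bool)} {f : (ι → Bool) → β} {c c' : ℕ}
    (h : Junta C c f) (hC : C' ⊆ C) (hc : c ≤ c') : Junta C' c' f :=
  let ⟨S, hS, hd⟩ := h
  ⟨S, hS.trans hc, hd.mono hC subset_rfl⟩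

lemma ConstOn.mono {C C' : Set (ι → Bool)} {f : (ι → Bool) → β} (h : ConstOn C f)
    (hC : C' ⊆ C) : ConstOn C' f := fun x hx y hy => h x (hC hx) y (hC hy)

lemma ConstOn.junta {C : Set (ι → Bool)} {f : (ι → Bool) → β} (h : ConstOn C f) (c : ℕ) :
    Junta C c f := ⟨∅, by simp, fun x hx y hy _ => h x hx y hy⟩

lemma Junta.congr {C : Set (ι → Bool)} {f g : (ι → Bool) → β} {c : ℕ} (h : Junta C c f)
    (hfg : ∀ x ∈ C, f x = g x) : Junta C c g :=
  let ⟨S, hS, hd⟩ := h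
  ⟨S, hS, fun x hx y hy hxy => by rw [← hfg x hx, ← hfg y hy]; exact hd x hx y hy hxy⟩

/-- Fixing the relevant coordinates of a junta to those of a given point makes it constant. -/
lemma Junta.exists_fix {C : Subcube ι} {f : (ι → Bool) → β} {c : ℕ} (h : Junta C.points c f)
    {x : ι → Bool} (hx : x ∈ C.points) :
    ∃ C' : Subcube ι, C'.Refines C c ∧ ∀ y ∈ C'.points, f y = f x := by
  classical
  obtain ⟨S, hS, hd⟩ := h
  refine ⟨C.fix S x, (Subcube.fix_refines hx S).mono hS, fun y hy => ?_⟩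
  exact hd y ((Subcube.fix_refines hx S).1 hy) x hx fun k hk => Subcube.eq_of_mem_fix hy hk

/-- A junta depending on at most `c` coordinates has at most `2 ^ c` values. -/
lemma Junta.exists_values {C : Set (ι → Bool)} {f : (ι → Bool) → β} {c : ℕ} (h : Junta C c f) :
    ∃ V : Finset β, V.card ≤ 2 ^ c ∧ ∀ x ∈ C, f x ∈ V := by
  classical
  obtain ⟨S, hS, hd⟩ := h
  by_cases hne : C.Nonempty
  · let tr : (ι → Bool) → Finset ι := fun x => S.filter fun k => x k = true
    -- Each pattern on `S` is sent to the value of `f` at some point of `C` with that pattern;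
    -- `hne.some` only serves patterns that do not occur.
    let g : Finset ι → β := fun s => if hs : ∃ x ∈ C, tr x = s then f hs.choose else f hne.some
    refine ⟨S.powerset.image g, Finset.card_image_le.trans ?_, fun x hx => ?_⟩
    · rw [Finset.card_powerset]
      exact Nat.pow_le_pow_right (by norm_num) hS
    · refine Finset.mem_image.2 ⟨tr x, by simp [tr], ?_⟩
      have hs : ∃ y ∈ C, tr y = tr x := ⟨x, hx, rfl⟩
      simp only [g, dif_pos hs]
      refine hd _ hs.choose_spec.1 x hx fun k hk => ?_
      have h1 := congrArg (k ∈ ·) hs.choose_spec.2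
      simp only [tr, Finset.mem_filter, hk, true_and, eq_iff_iff] at h1
      exact Bool.eq_iff_iff.2 h1
  · exact ⟨∅, by simp, fun x hx => (hne ⟨x, hx⟩).elim⟩

end Junta

/-! ### Hard attention on infinite streams -/

section Attention

/-- The key by which positions are compared: the score, ties broken to the right. -/
def selKey (a : ℕ → ℝ) (j : ℕ) : ℝ ×ₗ ℕ := toLex (a j, j)

lemma exists_selKey_max (a : ℕ → ℝ) (p : ℕ) : ∃ j ≤ p, ∀ k ≤ p, selKey a k ≤ selKey a j := by
  obtain ⟨j, hj, h⟩ := Finset.exists_max_image (Finset.range (p + 1)) (selKey a) ⟨0, by simp⟩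
  exact ⟨j, by simpa [Nat.lt_succ_iff] using hj,
    fun k hk => h k (by simpa [Nat.lt_succ_iff] using hk)⟩

/-- The rightmost position `j ≤ p` that maximises `a`. -/
noncomputable def sel (a : ℕ → ℝ) (p : ℕ) : ℕ := (exists_selKey_max a p).choose

lemma sel_le (a : ℕ → ℝ) (p : ℕ) : sel a p ≤ p := (exists_selKey_max a p).choose_spec.1

lemma selKey_le_sel (a : ℕ → ℝ) {p k : ℕ} (hk : k ≤ p) : selKey a k ≤ selKey a (sel a p) :=
  (exists_selKey_max a p).choose_spec.2 k hk

/-- The position is part of the key, so there are no ties between different positions and the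
maximiser is unique. -/
lemma selKey_snd {a b : ℕ → ℝ} {j k : ℕ} (h : selKey a j = selKey b k) : j = k :=
  congrArg (fun z => (ofLex z).2) h

lemma eq_sel {a : ℕ → ℝ} {p j : ℕ} (hj : j ≤ p) (h : ∀ k ≤ p, selKey a k ≤ selKey a j) :
    sel a p = j :=
  selKey_snd (le_antisymm (h _ (sel_le a p)) (selKey_le_sel a hj))

lemma sel_congr {a b : ℕ → ℝ} {p : ℕ} (h : ∀ j ≤ p, a j = b j) : sel a p = sel b p := by
  refine eq_sel (sel_le b p) fun k hk => ?_
  have h1 := selKey_le_sel b hk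
  simpa only [selKey, h k hk, h _ (sel_le b p)] using h1

/-- The right side is the condition in `uhat`: the lexicographic order encodes the rightmost
tie-break. -/
lemma eq_sel_iff {a : ℕ → ℝ} {p j : ℕ} :
    j = sel a p ↔ j ≤ p ∧ (∀ k, k ≤ p → a k ≤ a j) ∧ (∀ k, k ≤ p → j < k → a k < a j) := by
  constructor
  · rintro rfl
    refine ⟨sel_le a p, fun k hk => ?_, fun k hk hlt => ?_⟩
    · have := selKey_le_sel a hk
      rw [selKey, selKey, Prod.Lex.toLex_le_toLex] at this
      rcases this with h | h
      · exact h.le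
      · exact h.1.le
    · have := selKey_le_sel a hk
      rw [selKey, selKey, Prod.Lex.toLex_le_toLex] at this
      rcases this with h | h
      · exact h
      · exact absurd h.2 (by simpa using hlt)
  · rintro ⟨hj, h1, h2⟩
    refine (eq_sel hj fun k hk => ?_).symm
    rw [selKey, selKey, Prod.Lex.toLex_le_toLex]
    rcases lt_or_ge j k with h | h
    · exact Or.inl (h2 k hk h)
    · rcases (h1 k hk).lt_or_eq with h' | h'
      · exact Or.inl h'
      · exact Or.inr ⟨h', h⟩

/-- A layer of unique hard attention acting on streams of activations in `α`, with heads `η`. -/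
structure HardLayer (α η : Type*) where
  score : η → α → α → ℝ
  comb : (η → α) → α

variable {α η : Type*}

/-- The activation selected by head `h` for the query `v` at position `p`. -/
noncomputable def HardLayer.attend (ℓ : HardLayer α η) (h : η) (v : α) (X : ℕ → α) (p : ℕ) : α :=
  X (sel (fun j => ℓ.score h v (X j)) p)

/-- The stream of activations after a layer. -/
noncomputable def HardLayer.step (ℓ : HardLayer α η) (X : ℕ → α) (p : ℕ) : α :=
  ℓ.comb fun h => ℓ.attend h (X p) X p

/-- The stream of activations after a list of layers. -/
noncomputable def runLayers (ls : List (HardLayer α η)) (X : ℕ → α) : ℕ → α :=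
  ls.foldl (fun X ℓ => ℓ.step X) X

@[simp] lemma runLayers_nil (X : ℕ → α) : runLayers ([] : List (HardLayer α η)) X = X := rfl

@[simp] lemma runLayers_cons (ℓ : HardLayer α η) (ls : List (HardLayer α η)) (X : ℕ → α) :
    runLayers (ℓ :: ls) X = runLayers ls (ℓ.step X) := rfl

lemma HardLayer.attend_congr (ℓ : HardLayer α η) (h : η) (v : α) {X Y : ℕ → α} {p : ℕ}
    (hXY : ∀ j ≤ p, X j = Y j) : ℓ.attend h v X p = ℓ.attend h v Y p := by
  have : sel (fun j => ℓ.score h v (X j)) p = sel (fun j => ℓ.score h v (Y j)) p :=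
    sel_congr fun j hj => by rw [hXY j hj]
  rw [attend, attend, this, hXY _ (sel_le _ _)]

lemma HardLayer.step_congr (ℓ : HardLayer α η) {X Y : ℕ → α} {p : ℕ}
    (hXY : ∀ j ≤ p, X j = Y j) : ℓ.step X p = ℓ.step Y p := by
  simp only [step, hXY p le_rfl, ℓ.attend_congr _ _ hXY]

/-- Causality: activations depend only on the earlier part of the stream. -/
lemma runLayers_congr (ls : List (HardLayer α η)) {X Y : ℕ → α} {p : ℕ}
    (hXY : ∀ j ≤ p, X j = Y j) : runLayers ls X p = runLayers ls Y p := by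
  induction ls generalizing X Y with
  | nil => exact hXY p le_rfl
  | cons ℓ ls ih =>
    exact ih fun j hj => ℓ.step_congr fun k hk => hXY k (hk.trans hj)

end Attention

/-! ### Transformers as layers on streams -/

section Bridge

variable {V : Type*}

open Matrix in
/-- The stream layer computed by a Transformer layer. -/
noncomputable def Layer.toHard {d m H : ℕ} (ℓ : Layer d m H) : HardLayer (Fin d → ℝ) (Fin H) where
  score h u v := ((u ᵥ* ℓ.WQ h) ᵥ* (ℓ.WK h).transpose) ⬝ᵥ v
  comb z := ℓ.mlp ((fun p : Fin H × Fin m => (z p.1 ᵥ* ℓ.WV p.1) p.2) ᵥ* ℓ.WO)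

open Matrix in
-- Row `i` of the attention matrix is a unit vector, so multiplying by it copies a single row of
-- `X`.
lemma uhat_mul_row {n d : ℕ} (A : Matrix (Fin n) (Fin n) ℝ) (a : ℕ → ℝ) (i : Fin n)
    (ha : ∀ j : Fin n, A i j = a j) (X : Matrix (Fin n) (Fin d) ℝ) :
    (uhat A * X) i = X ⟨sel a i, (sel_le a i).trans_lt i.2⟩ := by
  classical
  have hu : ∀ j : Fin n, uhat A i j = if (j : ℕ) = sel a i then 1 else 0 := by
    intro j
    simp only [uhat, Matrix.of_apply]
    refine if_congr ?_ rfl rfl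
    rw [eq_sel_iff]
    simp only [ha]
    refine and_congr Iff.rfl (and_congr ?_ ?_)
    · exact ⟨fun h k hk => h ⟨k, hk.trans_lt i.2⟩ hk, fun h k hk => h k hk⟩
    · exact ⟨fun h k hk => h ⟨k, hk.trans_lt i.2⟩ hk, fun h k hk => h k hk⟩
  funext k
  rw [Matrix.mul_apply, Finset.sum_eq_single ⟨sel a i, (sel_le a i).trans_lt i.2⟩]
  · rw [hu]; simp
  · intro j _ hj
    rw [hu, if_neg (fun h => hj (Fin.ext h)), zero_mul]
  · simp

open Matrix in
-- `W_V`, `W_O` and the MLP act only on the rows already selected, so they can be absorbed into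
-- `comb`. Passing to streams removes the string length from the types, which makes prompts of
-- different lengths comparable.
lemma Layer.apply_eq_step {d m H n : ℕ} (ℓ : Layer d m H) (X : Matrix (Fin n) (Fin d) ℝ)
    (Y : ℕ → Fin d → ℝ) (hXY : ∀ i : Fin n, X i = Y i) (i : Fin n) :
    ℓ.apply X i = ℓ.toHard.step Y i := by
  have hatt : ∀ h, (uhat (X * ℓ.WQ h * (ℓ.WK h).transpose * X.transpose) * X) i
      = ℓ.toHard.attend h (Y i) Y i := by
    intro h
    rw [uhat_mul_row _ (fun j => ℓ.toHard.score h (Y i) (Y j)) i, hXY]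
    · rfl
    · intro j
      rw [← hXY, ← hXY, Matrix.mul_apply']
      simp only [Layer.toHard]
      congr 1
  have hhead : ∀ h, ℓ.head h X i = ℓ.toHard.attend h (Y i) Y i ᵥ* ℓ.WV h := by
    intro h
    rw [← hatt]
    rfl
  change ℓ.mlp (ℓ.multiHead X i) = ℓ.mlp _
  congr 1
  change (fun p : Fin H × Fin m => ℓ.head p.1 X i p.2) ᵥ* ℓ.WO = _
  congr 1
  funext p
  rw [hhead]

/-- The stream layers of a Transformer. -/
noncomputable def UHAT.hardLayers (T : UHAT V) : List (HardLayer (Fin T.dim → ℝ) (Fin T.heads)) :=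
  T.layers.map Layer.toHard

/-- The stream of embeddings of a string, continued by zeros. -/
noncomputable def UHAT.embStream (T : UHAT V) (s : List V) (p : ℕ) : Fin T.dim → ℝ :=
  if h : p < s.length then T.tokEmb s[p] + T.posEmb p else 0

lemma foldl_apply_eq_runLayers {d m H n : ℕ} (ls : List (Layer d m H))
    (X : Matrix (Fin n) (Fin d) ℝ) (Y : ℕ → Fin d → ℝ) (hXY : ∀ i : Fin n, X i = Y i)
    (i : Fin n) :
    (ls.foldl (fun X ℓ => ℓ.apply X) X) i = runLayers (ls.map Layer.toHard) Y i := by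
  induction ls generalizing X Y with
  | nil => exact hXY i
  | cons ℓ ls ih => exact ih _ _ fun j => ℓ.apply_eq_step X Y hXY j

lemma UHAT.next_eq (T : UHAT V) {s : List V} (hs : s ≠ []) :
    T.next s = T.decode (runLayers T.hardLayers (T.embStream s) (s.length - 1)) := by
  have h : s.length - 1 < s.length := Nat.sub_lt (List.length_pos_iff.2 hs) one_pos
  rw [UHAT.next]
  congr 1
  funext k
  rw [dif_pos h]
  refine congrFun (foldl_apply_eq_runLayers T.layers (T.embed s) (T.embStream s) ?_
    ⟨s.length - 1, h⟩) k
  intro i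
  simp [UHAT.embed, UHAT.embStream]
  rfl

end Bridge

/-! ### Making the activations of one position constant -/

section PositionFix

variable {ι α η : Type*}

/-- If all rows visible from position `p` are `c`-juntas, then fixing `c` coordinates makes the row
selected by one head for a given query constant. -/
lemma HardLayer.exists_fix_attend [Finite ι] (ℓ : HardLayer α η) (h : η) (v : α)
    {C : Subcube ι} {X : (ι → Bool) → ℕ → α} {p c : ℕ}
    (hX : ∀ j ≤ p, Junta C.points c fun x => X x j) :
    ∃ C' : Subcube ι, C'.Refines C c ∧ ConstOn C'.points fun x => ℓ.attend h v (X x) p := by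
  classical
  let key : (ι → Bool) × ℕ → ℝ ×ₗ ℕ := fun z => selKey (fun j => ℓ.score h v (X z.1 j)) z.2
  -- The maximum is over inputs and positions jointly: once row `j₀` is frozen at its value on `x₀`,
  -- no other row can beat it on any input left.
  obtain ⟨⟨x₀, j₀⟩, hm, hmax⟩ := Set.exists_max_image (C.points ×ˢ Set.Iic p) key
    ((Set.toFinite C.points).prod (Set.finite_Iic p)) ⟨(C.base, 0), C.base_mem, Nat.zero_le p⟩
  obtain ⟨hx₀, hj₀⟩ : x₀ ∈ C.points ∧ j₀ ≤ p := hm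
  obtain ⟨C', hC', hc⟩ := (hX j₀ hj₀).exists_fix hx₀
  have hsel : ∀ x ∈ C'.points, ℓ.attend h v (X x) p = X x₀ j₀ := by
    intro x hx
    have : sel (fun j => ℓ.score h v (X x j)) p = j₀ := by
      refine eq_sel hj₀ fun k hk => ?_
      have h1 := hmax (x, k) ⟨hC'.1 hx, hk⟩
      have h2 : selKey (fun j => ℓ.score h v (X x j)) j₀ = key (x₀, j₀) := by
        simp only [selKey, key, hc x hx]
      rw [h2]
      exact h1
    rw [HardLayer.attend, this, hc x hx]
  exact ⟨C', hC', fun x hx y hy => by simp only [hsel x hx, hsel y hy]⟩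

/-- Fixing few coordinates makes finitely many functions constant if each can be made so. -/
lemma exists_fix_forall {κ : Type*} (s : Finset κ) (P : κ → Set (ι → Bool) → Prop)
    (hP : ∀ k C C', C' ⊆ C → P k C → P k C') {c : ℕ} {C : Subcube ι}
    (h : ∀ k ∈ s, ∀ C' : Subcube ι, C'.points ⊆ C.points →
      ∃ C'' : Subcube ι, C''.Refines C' c ∧ P k C''.points) :
    ∃ C' : Subcube ι, C'.Refines C (s.card * c) ∧ ∀ k ∈ s, P k C'.points := by
  classical
  induction s using Finset.induction_on with
  | empty => exact ⟨C, Subcube.Refines.refl C _, by simp⟩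
  | insert a s ha ih =>
    obtain ⟨C₁, h₁, hP₁⟩ := ih fun k hk => h k (Finset.mem_insert_of_mem hk)
    obtain ⟨C₂, h₂, hP₂⟩ := h a (Finset.mem_insert_self a s) C₁ h₁.1
    refine ⟨C₂, (h₂.trans h₁).mono ?_, fun k hk => ?_⟩
    · rw [Finset.card_insert_of_notMem ha]; linarith [Nat.succ_mul s.card c]
    · rcases Finset.mem_insert.1 hk with rfl | hk
      · exact hP₂
      · exact hP k _ _ h₂.1 (hP₁ k hk)

/-- Since the row at `p` is constant, each head has a single query, and the heads can be frozen one
after the other at cost `c` each. -/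
lemma HardLayer.exists_fix_step [Finite ι] [Fintype η] (ℓ : HardLayer α η)
    {C : Subcube ι} {X : (ι → Bool) → ℕ → α} {p c : ℕ}
    (hX : ∀ j ≤ p, Junta C.points c fun x => X x j) (hp : ConstOn C.points fun x => X x p) :
    ∃ C' : Subcube ι, C'.Refines C (Fintype.card η * c) ∧
      ConstOn C'.points fun x => ℓ.step (X x) p := by
  obtain ⟨C', hC', hc⟩ := exists_fix_forall (C := C) (c := c) (Finset.univ : Finset η)
    (fun h D => ConstOn D fun x => ℓ.attend h (X C.base p) (X x) p)
    (fun _ _ _ hC h => h.mono hC)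
    (fun h _ D hD => ℓ.exists_fix_attend h _ fun j hj => (hX j hj).mono hD le_rfl)
  refine ⟨C', hC', fun x hx y hy => ?_⟩
  simp only [HardLayer.step]
  congr 1
  funext h
  have hb : ∀ z ∈ C'.points, X z p = X C.base p := fun z hz => hp z (hC'.1 hz) _ C.base_mem
  rw [hb x hx, hb y hy]
  exact hc h (Finset.mem_univ h) x hx y hy

/-- If the rows before position `p` are `c`-juntas on all layers and the input row at `p` is
constant, then fixing boundedly many coordinates makes the row at `p` constant on all layers. -/
lemma exists_fix_position [Finite ι] [Fintype η] (ls : List (HardLayer α η))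
    {C : Subcube ι} {X : (ι → Bool) → ℕ → α} {p c : ℕ}
    (hX : ∀ k, ∀ j < p, Junta C.points c fun x => runLayers (ls.take k) (X x) j)
    (hp : ConstOn C.points fun x => X x p) :
    ∃ C' : Subcube ι, C'.Refines C (ls.length * (Fintype.card η * c)) ∧
      ∀ k, ConstOn C'.points fun x => runLayers (ls.take k) (X x) p := by
  induction ls generalizing C X with
  | nil => exact ⟨C, Subcube.Refines.refl C _, fun k => by simpa using hp⟩
  | cons ℓ ls ih =>
    obtain ⟨C₁, h₁, hc₁⟩ := ℓ.exists_fix_step (C := C) (X := X) (p := p) (c := c)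
      (fun j hj => by
        rcases hj.lt_or_eq with hj | rfl
        · simpa using hX 0 j hj
        · exact hp.junta c) hp
    obtain ⟨C₂, h₂, hc₂⟩ := ih (C := C₁) (X := fun x => ℓ.step (X x))
      (fun k j hj => by simpa using (hX (k + 1) j hj).mono h₁.1 le_rfl) hc₁
    refine ⟨C₂, (h₂.trans h₁).mono ?_, fun k => ?_⟩
    · rw [List.length_cons]; linarith [Nat.succ_mul ls.length (Fintype.card η * c)]
    · cases k with
      | zero => simpa using hp.mono (h₂.1.trans h₁.1)
      | succ k => simpa using hc₂ k

/-- The same for a block of `r` consecutive positions. -/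
lemma exists_fix_positions [Finite ι] [Fintype η] (ls : List (HardLayer α η))
    {C : Subcube ι} {X : (ι → Bool) → ℕ → α} {p c : ℕ}
    (hX : ∀ k, ∀ j < p, Junta C.points c fun x => runLayers (ls.take k) (X x) j) (r : ℕ)
    (hp : ∀ q, p ≤ q → q < p + r → ConstOn C.points fun x => X x q) :
    ∃ C' : Subcube ι, C'.Refines C (r * (ls.length * (Fintype.card η * c))) ∧
      ∀ q, p ≤ q → q < p + r → ∀ k, ConstOn C'.points fun x => runLayers (ls.take k) (X x) q := by
  induction r with
  | zero => exact ⟨C, Subcube.Refines.refl C _, fun q h1 h2 => by omega⟩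
  | succ r ih =>
    obtain ⟨C₁, h₁, hc₁⟩ := ih fun q h1 h2 => hp q h1 (by omega)
    obtain ⟨C₂, h₂, hc₂⟩ := exists_fix_position ls (C := C₁) (X := X) (p := p + r) (c := c)
      -- Rows treated earlier are constant, hence again `c`-juntas, so the cost per position does
      -- not grow along the block.
      (fun k j hj => by
        rcases lt_or_ge j p with h | h
        · exact (hX k j h).mono h₁.1 le_rfl
        · exact (hc₁ j h hj k).junta c)
      ((hp (p + r) (by omega) (by omega)).mono h₁.1)
    refine ⟨C₂, (h₂.trans h₁).mono (by rw [Nat.succ_mul]), fun q h1 h2 k => ?_⟩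
    rcases (Nat.lt_succ_iff.1 (show q < (p + r) + 1 by omega)).lt_or_eq with h | rfl
    · exact (hc₁ q h1 h k).mono h₂.1
    · exact hc₂ k

end PositionFix

/-! ### Restrictions under which all activations become juntas -/

section Greedy

variable {ι Q : Type*}

/-- Greedy refinement: as long as more than `M` of the properties in `U` fail, `a` of them can be
established by fixing `c` coordinates. -/
lemma exists_greedy_refinement (P : Q → Set (ι → Bool) → Prop)
    (hP : ∀ q C C', C' ⊆ C → P q C → P q C') {a M c : ℕ} (ha : 0 < a) (n : ℕ) (U : Finset Q)
    (hn : U.card ≤ n) (C : Subcube ι)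
    (h : ∀ C' : Subcube ι, C'.points ⊆ C.points → ∀ U' ⊆ U, M < U'.card →
      (∀ q ∈ U', ¬ P q C'.points) → ∃ C'' : Subcube ι, C''.Refines C' c ∧
        ∃ D ⊆ U', a ≤ D.card ∧ ∀ q ∈ D, P q C''.points) :
    ∃ (C' : Subcube ι) (s : ℕ), C'.Refines C (s * c) ∧ s * a ≤ U.card ∧
      ∃ U' ⊆ U, U'.card ≤ M ∧ ∀ q ∈ U, q ∉ U' → P q C'.points := by
  classical
  induction n generalizing U C with
  | zero =>
    refine ⟨C, 0, Subcube.Refines.refl C _, by simp, U, subset_rfl, by omega, fun q h1 h2 => ?_⟩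
    exact (h2 h1).elim
  | succ n ih =>
    set U₁ := U.filter fun q => ¬ P q C.points with hU₁
    have hsub : U₁ ⊆ U := Finset.filter_subset _ _
    rcases le_or_gt U₁.card M with hM | hM
    · refine ⟨C, 0, Subcube.Refines.refl C _, by simp, U₁, hsub, hM, fun q h1 h2 => ?_⟩
      by_contra h3
      exact h2 (Finset.mem_filter.2 ⟨h1, h3⟩)
    · obtain ⟨C₂, h₂, D, hD, haD, hPD⟩ := h C subset_rfl U₁ hsub hM
        fun q hq => (Finset.mem_filter.1 hq).2
      have hcard : (U₁ \ D).card + D.card = U₁.card := Finset.card_sdiff_add_card_eq_card hD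
      have hle := Finset.card_le_card hsub
      obtain ⟨C', s, h', hs, U', hU', hM', hP'⟩ := ih (U₁ \ D) (by omega) C₂
        fun C' hC' U' hU' => h C' (hC'.trans h₂.1) U' (hU'.trans (Finset.sdiff_subset.trans hsub))
      refine ⟨C', s + 1, (h'.trans h₂).mono (by rw [Nat.succ_mul, add_comm]),
        by rw [Nat.succ_mul]; omega, U', hU'.trans (Finset.sdiff_subset.trans hsub), hM',
        fun q h1 h2 => ?_⟩
      by_cases h3 : q ∈ D
      · exact hP q _ _ h'.1 (hPD q h3)
      by_cases h4 : q ∈ U₁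
      · exact hP' q (Finset.mem_sdiff.2 ⟨h4, h3⟩) h2
      · refine hP q _ _ (h'.1.trans h₂.1) ?_
        by_contra h5
        exact h4 (Finset.mem_filter.2 ⟨h1, h5⟩)

/-- A finite set with at least `l` elements has at least `l` elements among the top `l`. -/
lemma le_card_filter_top {κ R : Type*} [LinearOrder R] (G : Finset κ) (key : κ → R) {l : ℕ}
    (hl : l ≤ G.card) :
    l ≤ (G.filter fun g => (G.filter fun g' => key g < key g').card < l).card := by
  classical
  set T := G.filter fun g => (G.filter fun g' => key g < key g').card < l with hT
  by_cases hGT : (G \ T).Nonempty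
  · obtain ⟨g, hg, hmax⟩ := Finset.exists_max_image (G \ T) key hGT
    obtain ⟨hgG, hgT⟩ := Finset.mem_sdiff.1 hg
    have h1 : l ≤ (G.filter fun g' => key g < key g').card := by
      by_contra h
      exact hgT (Finset.mem_filter.2 ⟨hgG, not_le.1 h⟩)
    refine h1.trans (Finset.card_le_card fun g' hg' => ?_)
    obtain ⟨h2, h3⟩ := Finset.mem_filter.1 hg'
    by_contra h4
    exact absurd (hmax g' (Finset.mem_sdiff.2 ⟨h2, h4⟩)) (not_le.2 h3)
  · rw [Finset.not_nonempty_iff_eq_empty, Finset.sdiff_eq_empty_iff_subset] at hGT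
    exact hl.trans (Finset.card_le_card hGT)

end Greedy

section Restriction

variable {ι α η I : Type*}

/-- If a head always selects one of the positions in `W`, then its output is a junta. -/
lemma HardLayer.junta_attend (ℓ : HardLayer α η) (h : η) (v : α) {C : Set (ι → Bool)}
    {X : (ι → Bool) → ℕ → α} {p c l : ℕ} (W : Finset ℕ) (hW : W.card ≤ l)
    (hX : ∀ j ≤ p, Junta C c fun x => X x j)
    (hsel : ∀ x ∈ C, sel (fun j => ℓ.score h v (X x j)) p ∈ W) :
    Junta C (l * c) fun x => ℓ.attend h v (X x) p := by
  classical
  choose! S hS hd using hX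
  refine ⟨(W.filter (· ≤ p)).biUnion S, ?_, fun x hx y hy hxy => ?_⟩
  · refine (Finset.card_biUnion_le_card_mul _ _ c fun j hj => hS j ?_).trans
      (Nat.mul_le_mul_right c ((Finset.card_le_card (Finset.filter_subset _ _)).trans hW))
    exact (Finset.mem_filter.1 hj).2
  · have hrow : ∀ j ∈ W, j ≤ p → X x j = X y j := fun j hj hjp =>
      hd j hjp x hx y hy fun k hk =>
        hxy k (Finset.mem_biUnion.2 ⟨j, Finset.mem_filter.2 ⟨hj, hjp⟩, hk⟩)
    have hkey : ∀ j ∈ W, j ≤ p → selKey (fun j => ℓ.score h v (X x j)) j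
        = selKey (fun j => ℓ.score h v (X y j)) j := fun j hj hjp => by
      simp only [selKey, hrow j hj hjp]
    have hx' := hsel x hx
    have hy' := hsel y hy
    have hxp := sel_le (fun j => ℓ.score h v (X x j)) p
    have hyp := sel_le (fun j => ℓ.score h v (X y j)) p
    have heq : sel (fun j => ℓ.score h v (X x j)) p = sel (fun j => ℓ.score h v (X y j)) p := by
      refine selKey_snd (a := fun j => ℓ.score h v (X y j)) (b := fun j => ℓ.score h v (X y j))
        (le_antisymm (selKey_le_sel _ hxp) ?_)
      rw [← hkey _ hx' hxp, ← hkey _ hy' hyp]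
      exact selKey_le_sel _ hyp
    change X x _ = X y _
    rw [heq]
    exact hrow _ hy' hyp

/-- Number of properties established by one greedy step. -/
def greedyGain (H m c : ℕ) : ℕ := 2 * c * m * (2 ^ c * H)

/-- Number of top candidates considered for every head and query. -/
def topLength (H m c : ℕ) : ℕ := 2 * c * m * (greedyGain H m c * 2 ^ c)

/-- Junta size after one layer. -/
def layerBound (H m c : ℕ) : ℕ := c + 2 ^ c * H * (topLength H m c * c)

/-- One layer: if the rows at the positions in `Pos` are `c`-juntas, then after fixing a small
fraction of the coordinates, the rows after the layer are juntas of bounded size. -/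
lemma HardLayer.exists_refines_junta_step [Finite ι] [Fintype η] (ℓ : HardLayer α η)
    {H m c N : ℕ} (hη : Fintype.card η ≤ H) (hH : 0 < H) (hm : 0 < m) (hc : 0 < c)
    (Pos : Finset (I × ℕ)) (hPos : ∀ i j k, (i, j) ∈ Pos → k ≤ j → (i, k) ∈ Pos)
    (hN : Pos.card ≤ N) {C : Subcube ι} {X : (ι → Bool) → I → ℕ → α}
    (hX : ∀ i j, (i, j) ∈ Pos → Junta C.points c fun x => X x i j) :
    ∃ (C' : Subcube ι) (s : ℕ), C'.Refines C s ∧ s * m ≤ N ∧ ∀ i j, (i, j) ∈ Pos →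
      Junta C'.points (layerBound H m c) fun x => ℓ.step (X x i) j := by
  classical
  have hV : ∀ p : I × ℕ, ∃ V : Finset α, V.card ≤ 2 ^ c ∧
      (p ∈ Pos → ∀ x ∈ C.points, X x p.1 p.2 ∈ V) := by
    intro p
    by_cases hp : p ∈ Pos
    · obtain ⟨V, h1, h2⟩ := (hX p.1 p.2 hp).exists_values
      exact ⟨V, h1, fun _ => h2⟩
    · exact ⟨∅, by simp, fun h => (hp h).elim⟩
  choose V hVc hVm using hV
  -- candidates: a position together with a possible value of its row
  set K : Finset (Σ _ : I × ℕ, α) := Pos.sigma V with hK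
  have hKcard : K.card ≤ N * 2 ^ c := by
    rw [hK, Finset.card_sigma]
    exact (Finset.sum_le_card_nsmul _ _ _ fun p _ => hVc p).trans
      (by rw [smul_eq_mul]; exact Nat.mul_le_mul_right _ hN)
  -- The at most `|U| / A ≤ N / (2cm)` greedy steps and the at most `M` leftover queries cost `c`
  -- bits each, together at most `N / m`. The length `l` is such that more than `M` queries with `l`
  -- candidates each give more than `|K| * A` incidences.
  set A := greedyGain H m c with hA
  set l := topLength H m c with hl
  set M := N / (2 * c * m) with hM
  have h2cm : 0 < 2 * c * m := by positivity
  have hApos : 0 < A := by rw [hA, greedyGain]; positivity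
  have hlpos : 0 < l := by rw [hl, topLength]; positivity
  -- The query value is a fixed element of `V`, not the row at the current input; the dependence of
  -- the query on the input is put back at the end.
  let P : ((Σ _ : I × ℕ, α) × η) → Set (ι → Bool) → Prop := fun q D =>
    Junta D (l * c) fun x => ℓ.attend q.2 q.1.2 (X x q.1.1.1) q.1.1.2
  have hPmono : ∀ q D D', D' ⊆ D → P q D → P q D' := fun q D D' hD h => h.mono hD le_rfl
  set U : Finset ((Σ _ : I × ℕ, α) × η) := K ×ˢ Finset.univ with hU
  have hUcard : U.card ≤ N * 2 ^ c * H := by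
    rw [hU, Finset.card_product, Finset.card_univ]
    exact Nat.mul_le_mul hKcard hη
  have hUPos : ∀ q ∈ U, q.1.1 ∈ Pos := fun q hq =>
    (Finset.mem_sigma.1 (Finset.mem_product.1 hq).1).1
  have hrows : ∀ q ∈ U, ∀ j ≤ q.1.1.2, Junta C.points c fun x => X x q.1.1.1 j :=
    fun q hq j hj => hX _ _ (hPos _ _ _ (hUPos q hq) hj)
  -- the candidates for `q` that are possible on `D`, and their keys
  let G : Subcube ι → ((Σ _ : I × ℕ, α) × η) → Finset (Σ _ : I × ℕ, α) := fun D q =>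
    K.filter fun g => g.1.1 = q.1.1.1 ∧ g.1.2 ≤ q.1.1.2 ∧
      ∃ x ∈ D.points, X x q.1.1.1 g.1.2 = g.2
  let key : ((Σ _ : I × ℕ, α) × η) → (Σ _ : I × ℕ, α) → ℝ ×ₗ ℕ := fun q g =>
    toLex (ℓ.score q.2 q.1.2 g.2, g.1.2)
  have hmemG : ∀ D : Subcube ι, D.points ⊆ C.points → ∀ q ∈ U, ∀ x ∈ D.points, ∀ j ≤ q.1.1.2,
      (⟨(q.1.1.1, j), X x q.1.1.1 j⟩ : Σ _ : I × ℕ, α) ∈ G D q := by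
    intro D hD q hq x hx j hj
    have hp : (q.1.1.1, j) ∈ Pos := hPos _ _ _ (hUPos q hq) hj
    exact Finset.mem_filter.2 ⟨Finset.mem_sigma.2 ⟨hp, hVm _ hp x (hD hx)⟩, rfl, hj, x, hx, rfl⟩
  let r : Subcube ι → ((Σ _ : I × ℕ, α) × η) → (Σ _ : I × ℕ, α) → Prop := fun D q g =>
    g ∈ (G D q).filter fun g => ((G D q).filter fun g' => key q g < key q g').card < l
  obtain ⟨C₁, s, h₁, hs, U', hU', hU'M, hP₁⟩ := exists_greedy_refinement (M := M) (c := c) P hPmono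
    hApos U.card U le_rfl C (by
      intro D hD U' hU' hMU' hnP
      have habove : ∀ q ∈ U', l ≤ (K.bipartiteAbove (r D) q).card := by
        intro q hq
        have hGl : l ≤ (G D q).card := by
          by_contra hlt
          -- With fewer than `l` candidates the selected position lies in a set of fewer than `l`
          -- positions, so the property would already hold.
          refine hnP q hq (ℓ.junta_attend q.2 q.1.2 ((G D q).image fun g => g.1.2)
            (Finset.card_image_le.trans (not_le.1 hlt).le)
            (fun j hj => (hrows q (hU' hq) j hj).mono hD le_rfl) fun x hx => ?_)
          exact Finset.mem_image.2 ⟨_, hmemG D hD q (hU' hq) x hx _ (sel_le _ _), rfl⟩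
        refine (le_card_filter_top (G D q) (key q) hGl).trans (Finset.card_le_card fun g hg => ?_)
        exact Finset.mem_filter.2 ⟨(Finset.mem_filter.1 (Finset.mem_filter.1 hg).1).1, hg⟩
      -- Double counting of pairs of a query in `U'` and one of its top candidates.
      obtain ⟨g, hgK, hgA⟩ : ∃ g ∈ K, A < (U'.bipartiteBelow (r D) g).card := by
        by_contra! hcon
        have h1 := Finset.card_mul_le_card_mul (r D) habove hcon
        have h2 : N < (M + 1) * (2 * c * m) := by
          rw [hM, mul_comm]; exact Nat.lt_mul_div_succ N h2cm
        have h3 : K.card * A ≤ N * (A * 2 ^ c) :=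
          (Nat.mul_le_mul_right A hKcard).trans_eq (by ring)
        have h4 : (M + 1) * (2 * c * m) * (A * 2 ^ c) ≤ U'.card * l := by
          rw [mul_assoc]
          exact Nat.mul_le_mul_right _ hMU'
        have h5 : N * (A * 2 ^ c) < (M + 1) * (2 * c * m) * (A * 2 ^ c) :=
          Nat.mul_lt_mul_of_pos_right h2 (by positivity)
        omega
      obtain ⟨q₀, hq₀⟩ := Finset.card_pos.1 (hApos.trans hgA)
      obtain ⟨hq₀U, hr₀⟩ := Finset.mem_filter.1 hq₀
      obtain ⟨-, hi₀, -, x₀, hx₀, hxg⟩ := Finset.mem_filter.1 (Finset.mem_filter.1 hr₀).1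
      have hgPos : g.1 ∈ Pos := (Finset.mem_sigma.1 hgK).1
      obtain ⟨D', hD', hfix⟩ := ((hX g.1.1 g.1.2 hgPos).mono hD le_rfl).exists_fix hx₀
      rw [hi₀, hxg] at hfix
      refine ⟨D', hD', _, Finset.filter_subset _ _, hgA.le, fun q hq => ?_⟩
      obtain ⟨hqU, hr⟩ := Finset.mem_filter.1 hq
      obtain ⟨hgG, hlt⟩ := Finset.mem_filter.1 hr
      obtain ⟨-, hi, hgp, -⟩ := Finset.mem_filter.1 hgG
      -- On `D'` the candidate `g` always occurs, so the winner sits at the position of `g` or is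
      -- one of the fewer than `l` candidates strictly above it.
      refine ℓ.junta_attend q.2 q.1.2
        (insert g.1.2 (((G D q).filter fun g' => key q g < key q g').image fun g => g.1.2))
        ((Finset.card_insert_le _ _).trans
          ((Nat.succ_le_succ Finset.card_image_le).trans (Nat.succ_le_of_lt hlt)))
        (fun j hj => (hrows q (hU' hqU) j hj).mono (hD'.1.trans hD) le_rfl) fun x hx => ?_
      have h1 := selKey_le_sel (fun j => ℓ.score q.2 q.1.2 (X x q.1.1.1 j)) hgp
      have h2 : selKey (fun j => ℓ.score q.2 q.1.2 (X x q.1.1.1 j)) g.1.2 = key q g := by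
        have := hfix x hx
        rw [← hi₀, hi] at this
        simp only [selKey, key, this]
      rcases h1.lt_or_eq with h3 | h3
      · refine Finset.mem_insert_of_mem (Finset.mem_image.2 ⟨_, Finset.mem_filter.2
          ⟨hmemG D hD q (hU' hqU) x (hD'.1 hx) _ (sel_le _ _), ?_⟩, rfl⟩)
        rw [← h2]
        exact h3
      · rw [← selKey_snd h3]
        exact Finset.mem_insert_self _ _)
  obtain ⟨C₂, h₂, hP₂⟩ := exists_fix_forall (C := C₁) (c := c) U' P hPmono (by
    intro q hq D hD
    obtain ⟨D', hD', hcon⟩ := ℓ.exists_fix_attend q.2 q.1.2 (C := D) (X := fun x => X x q.1.1.1)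
      (p := q.1.1.2) (c := c) fun j hj => (hrows q (hU' hq) j hj).mono (hD.trans h₁.1) le_rfl
    exact ⟨D', hD', hcon.junta _⟩)
  have hP : ∀ q ∈ U, P q C₂.points := by
    intro q hq
    by_cases hq' : q ∈ U'
    · exact hP₂ q hq'
    · exact hPmono q _ _ h₂.1 (hP₁ q hq hq')
  refine ⟨C₂, s * c + U'.card * c, h₂.trans h₁, ?_, fun i p hp => ?_⟩
  · have e1 : s * (2 * c * m) ≤ N := by
      have : s * (2 * c * m) * (2 ^ c * H) ≤ N * (2 ^ c * H) := by
        calc s * (2 * c * m) * (2 ^ c * H) = s * A := by rw [hA, greedyGain]; ring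
          _ ≤ U.card := hs
          _ ≤ N * 2 ^ c * H := hUcard
          _ = _ := by ring
      exact Nat.le_of_mul_le_mul_right this (by positivity)
    have e2 : U'.card * (2 * c * m) ≤ N :=
      (Nat.mul_le_mul_right _ hU'M).trans (Nat.div_mul_le_self N _)
    have e3 : 2 * ((s * c + U'.card * c) * m) = s * (2 * c * m) + U'.card * (2 * c * m) := by ring
    omega
  · obtain ⟨S, hS, hd⟩ := (hX i p hp).mono (h₂.1.trans h₁.1) le_rfl
    have hmem : ∀ v ∈ V (i, p), ∀ h : η, ((⟨(i, p), v⟩, h) : (Σ _ : I × ℕ, α) × η) ∈ U :=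
      fun v hv h => Finset.mem_product.2 ⟨Finset.mem_sigma.2 ⟨hp, hv⟩, Finset.mem_univ h⟩
    choose! B hB hBd using hP
    -- `S` determines the query value; the union collects the bits needed for every possible value
    -- and every head.
    refine ⟨S ∪ (V (i, p) ×ˢ Finset.univ).biUnion fun z => B (⟨(i, p), z.1⟩, z.2), ?_,
      fun x hx y hy hxy => ?_⟩
    · refine (Finset.card_union_le _ _).trans (Nat.add_le_add hS ?_)
      refine (Finset.card_biUnion_le_card_mul _ _ (l * c) fun z hz => ?_).trans ?_
      · exact hB _ (hmem _ (Finset.mem_product.1 hz).1 _)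
      · rw [Finset.card_product, Finset.card_univ]
        exact Nat.mul_le_mul_right _ (Nat.mul_le_mul (hVc _) hη)
    · have hv : X x i p = X y i p :=
        hd x hx y hy fun k hk => hxy k (Finset.mem_union_left _ hk)
      have hvV : X y i p ∈ V (i, p) := hVm (i, p) hp y (h₁.1 (h₂.1 hy))
      simp only [HardLayer.step, hv]
      congr 1
      funext h
      refine hBd _ (hmem _ hvV h) x hx y hy fun k hk => hxy k (Finset.mem_union_right _ ?_)
      exact Finset.mem_biUnion.2 ⟨(_, h), Finset.mem_product.2 ⟨hvV, Finset.mem_univ h⟩, hk⟩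

lemma le_layerBound (H m : ℕ) : id ≤ layerBound H m := fun c => Nat.le_add_right c _

/-- After fixing a small fraction of the coordinates, the rows at the positions in `Pos` are juntas
of bounded size on all layers. -/
lemma exists_refines_junta_runLayers [Finite ι] [Fintype η] (ls : List (HardLayer α η))
    {H m c N : ℕ} (hη : Fintype.card η ≤ H) (hH : 0 < H) (hm : 0 < m) (hc : 0 < c)
    (Pos : Finset (I × ℕ)) (hPos : ∀ i j k, (i, j) ∈ Pos → k ≤ j → (i, k) ∈ Pos)
    (hN : Pos.card ≤ N) {C : Subcube ι} {X : (ι → Bool) → I → ℕ → α}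
    (hX : ∀ i j, (i, j) ∈ Pos → Junta C.points c fun x => X x i j) :
    ∃ (C' : Subcube ι) (s : ℕ), C'.Refines C s ∧ s * m ≤ ls.length * N ∧
      ∀ k i j, (i, j) ∈ Pos →
        Junta C'.points ((layerBound H m)^[ls.length] c) fun x =>
          runLayers (ls.take k) (X x i) j := by
  induction ls generalizing C X c with
  | nil => exact ⟨C, 0, Subcube.Refines.refl C _, by simp, fun k i j h => by simpa using hX i j h⟩
  | cons ℓ ls ih =>
    obtain ⟨C₁, s₁, h₁, hs₁, hJ₁⟩ := ℓ.exists_refines_junta_step hη hH hm hc Pos hPos hN hX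
    obtain ⟨C₂, s₂, h₂, hs₂, hJ₂⟩ := ih (hc.trans_le (le_layerBound H m c)) hJ₁
    refine ⟨C₂, s₁ + s₂, h₂.trans h₁, ?_, fun k i j hij => ?_⟩
    · rw [List.length_cons, add_mul, add_mul]; omega
    · cases k with
      | zero =>
        simpa using (hX i j hij).mono (h₂.1.trans h₁.1)
          (Function.id_le_iterate_of_id_le (le_layerBound H m) (ls.length + 1) c)
      | succ k => simpa using hJ₂ k i j hij

end Restriction

/-! ### Chunks and prompts -/

lemma UHAT.embStream_eq {V : Type*} (T : UHAT V) (s : List V) (p : ℕ) :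
    T.embStream s p = (s[p]?).elim 0 fun v => T.tokEmb v + T.posEmb p := by
  rw [embStream]
  split_ifs with h
  · simp [List.getElem?_eq_getElem h]
  · simp [List.getElem?_eq_none (not_lt.1 h)]

/-- By causality later tokens leave earlier activations unchanged. So bounds proved for the bare
chunk hold in all prompts, and settled suffix positions stay settled. -/
lemma UHAT.runLayers_embStream_append {V : Type*} (T : UHAT V)
    (ls : List (HardLayer (Fin T.dim → ℝ) (Fin T.heads))) (s u : List V) {p : ℕ}
    (hp : p < s.length) :
    runLayers ls (T.embStream (s ++ u)) p = runLayers ls (T.embStream s) p :=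
  runLayers_congr ls fun j hj => by
    rw [T.embStream_eq, T.embStream_eq, List.getElem?_append_left (hj.trans_lt hp)]

namespace AgentGraph

variable {Ξ : Type*} {w : ℕ}

lemma incoming_congr {G G' : AgentGraph Ξ w} {t : ℕ} (h : ∀ i, ∀ s < t, G.emit i s = G'.emit i s)
    (j : Fin w) {s : ℕ} (hs : s ≤ t) : G.incoming j s = G'.incoming j s := by
  cases s with
  | zero => rfl
  | succ s => simp only [incoming, h _ s hs]

lemma receiveTokens_congr {G G' : AgentGraph Ξ w} {t : ℕ}
    (h : ∀ i, ∀ s < t, G.emit i s = G'.emit i s) (j : Fin w) {s : ℕ} (hs : s ≤ t) :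
    G.receiveTokens j s = G'.receiveTokens j s := by
  simp only [receiveTokens, incoming_congr h j hs]

lemma receiveTokens_of_le (G : AgentGraph Ξ w) {j : Fin w} {t : ℕ} (h : G.len j ≤ t) :
    G.receiveTokens j t = [] := by
  have : G.incoming j t = none := by
    cases t with
    | zero => rfl
    | succ t =>
      refine List.findSome?_eq_none_iff.2 fun i _ => ?_
      by_contra h'
      exact absurd (G.edge_lt i t j (Option.isSome_iff_ne_none.2 h')) (not_lt.2 h)
  rw [receiveTokens, this]

lemma length_receiveTokens_le (G : AgentGraph Ξ w) (j : Fin w) (t : ℕ) :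
    (G.receiveTokens j t).length ≤ 1 := by
  rw [receiveTokens]
  split <;> simp

lemma LastCoT.unique {G G' : AgentGraph Ξ w} {i : Fin w} {σ τ : Ξ} (h : G.LastCoT i σ)
    (h' : G'.LastCoT i τ) (he : ∀ t, G.emit i t = G'.emit i t) : σ = τ := by
  obtain ⟨t, ht, hl⟩ := h
  obtain ⟨t', ht', hl'⟩ := h'
  rcases lt_trichotomy t t' with hlt | rfl | hlt
  · exact (hl t' hlt τ ((he t').trans ht')).elim
  · rw [he, ht'] at ht
    exact (Emission.cot.inj ht).symm
  · exact (hl' t hlt σ ((he t).symm.trans ht)).elim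

end AgentGraph

namespace MultiAgentSystem

variable {α Ξ : Type*} (A : MultiAgentSystem α Ξ)

/-- First position of the chunk of agent `k`. -/
def chunkStart (n k : ℕ) : ℕ := n * k ⌈/⌉ A.width n

/-- Length of the chunk of agent `k`. -/
def chunkLen (n k : ℕ) : ℕ := A.chunkStart n (k + 1) - A.chunkStart n k

lemma chunkStart_eq (n k : ℕ) : A.chunkStart n k = (n * k + A.width n - 1) / A.width n :=
  Nat.ceilDiv_eq_add_pred_div _ _

lemma chunkStart_mono (n : ℕ) : Monotone (A.chunkStart n) := fun k l h => by
  rw [chunkStart_eq, chunkStart_eq]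
  exact Nat.div_le_div_right (Nat.sub_le_sub_right
    (Nat.add_le_add_right (Nat.mul_le_mul_left n h) _) 1)

lemma chunkStart_succ_le {n k : ℕ} (hk : k < A.width n) : A.chunkStart n (k + 1) ≤ n := by
  rw [chunkStart_eq, ← Nat.lt_succ_iff, Nat.div_lt_iff_lt_mul (A.width_pos n), Nat.succ_mul]
  have h1 : n * (k + 1) ≤ n * A.width n := Nat.mul_le_mul_left n hk
  have := A.width_pos n
  omega

/-- Raising the index by one adds `n ≤ w * K` to the numerator, hence at most `K` to the rounded
quotient. -/
lemma chunkLen_le {n K : ℕ} (h : n ≤ A.width n * K) (k : ℕ) : A.chunkLen n k ≤ K := by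
  have : A.chunkStart n (k + 1) ≤ A.chunkStart n k + K := by
    rw [chunkStart_eq, chunkStart_eq, ← Nat.add_mul_div_left _ _ (A.width_pos n)]
    refine Nat.div_le_div_right ?_
    have e : n * (k + 1) = n * k + n := by ring
    have := A.width_pos n
    omega
  rw [chunkLen]
  omega

lemma chunkStart_add_lt {n : ℕ} {i : Fin (A.width n)} {j : ℕ} (hj : j < A.chunkLen n i) :
    A.chunkStart n i + j < n := by
  have := A.chunkStart_succ_le i.2
  rw [chunkLen] at hj
  omega

/-- The chunk of agent `i` as a list of tokens. -/
def chunkTokens {n : ℕ} (x : Fin n → α) (i : Fin (A.width n)) : List (Token Ξ) :=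
  (A.chunk x i).map fun a => .sym (A.incl a)

lemma length_chunkTokens {n : ℕ} (x : Fin n → α) (i : Fin (A.width n)) :
    (A.chunkTokens x i).length = A.chunkLen n i := by
  have := A.chunkStart_succ_le i.2
  simp only [chunkTokens, chunk, List.length_map, List.length_drop, List.length_take,
    List.length_ofFn, chunkLen, chunkStart] at this ⊢
  omega

lemma getElem_chunkTokens {n : ℕ} (x : Fin n → α) (i : Fin (A.width n)) {j : ℕ}
    (hj : j < A.chunkLen n i) (h : j < (A.chunkTokens x i).length) :
    (A.chunkTokens x i)[j] = .sym (A.incl (x ⟨A.chunkStart n i + j, A.chunkStart_add_lt hj⟩)) := by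
  simp [chunkTokens, chunk, chunkStart]

/-- The part of a prompt after the chunk. -/
def suffix {n : ℕ} (x : Fin n → α) (i : Fin (A.width n)) (t : ℕ) : List (Token Ξ) :=
  .agentId i :: ((List.range t).flatMap ((A.graph x).nodeTokens i) ++
    (A.graph x).receiveTokens i t)

lemma prompt_eq {n : ℕ} (x : Fin n → α) (i : Fin (A.width n)) (t : ℕ) :
    A.prompt x i t = A.chunkTokens x i ++ A.suffix x i t := by
  simp [prompt, chunkTokens, suffix]

lemma length_prompt {n : ℕ} (x : Fin n → α) (i : Fin (A.width n)) (t : ℕ) :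
    (A.prompt x i t).length = A.chunkLen n i + (A.suffix x i t).length := by
  rw [prompt_eq, List.length_append, length_chunkTokens]

@[simp] lemma suffix_zero {n : ℕ} (x : Fin n → α) (i : Fin (A.width n)) :
    A.suffix x i 0 = [.agentId i] := rfl

lemma suffix_succ {n : ℕ} (x : Fin n → α) (i : Fin (A.width n)) (t : ℕ) :
    A.suffix x i (t + 1) = A.suffix x i t ++ (((A.graph x).emit i t).token?.toList ++
      (A.graph x).receiveTokens i (t + 1)) := by
  simp [suffix, List.range_succ, AgentGraph.nodeTokens]

/-- One emitted and one received token per time step: the source of the factor 2 in `nodeCost`. -/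
lemma length_suffix_succ_le {n : ℕ} (x : Fin n → α) (i : Fin (A.width n)) (t : ℕ) :
    (A.suffix x i (t + 1)).length ≤ (A.suffix x i t).length + 2 := by
  rw [suffix_succ, List.length_append, List.length_append]
  have h1 := (A.graph x).length_receiveTokens_le i (t + 1)
  have h2 : (((A.graph x).emit i t).token?.toList).length ≤ 1 := by
    cases ((A.graph x).emit i t).token? <;> simp
  omega

lemma prompt_succ {n : ℕ} (x : Fin n → α) (i : Fin (A.width n)) (t : ℕ) :
    ∃ u, A.prompt x i (t + 1) = A.prompt x i t ++ u :=
  ⟨_, by rw [prompt_eq, prompt_eq, suffix_succ, List.append_assoc]⟩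

lemma suffix_congr {n : ℕ} {x y : Fin n → α} {t : ℕ}
    (h : ∀ i, ∀ s < t, (A.graph x).emit i s = (A.graph y).emit i s) (i : Fin (A.width n)) :
    A.suffix x i t = A.suffix y i t := by
  rw [suffix, suffix, AgentGraph.receiveTokens_congr h i le_rfl]
  congr 2
  refine List.flatMap_congr fun s hs => ?_
  have hs' := List.mem_range.1 hs
  rw [AgentGraph.nodeTokens, AgentGraph.nodeTokens, AgentGraph.receiveTokens_congr h i hs'.le,
    h i s hs']

lemma prompt_of_le {n : ℕ} (x : Fin n → α) {i : Fin (A.width n)} {t : ℕ}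
    (h : (A.graph x).len i ≤ t) : A.prompt x i t = A.prompt x i ((A.graph x).len i) := by
  induction t, h using Nat.le_induction with
  | base => rfl
  | succ t ht ih =>
    rw [← ih, prompt_eq, prompt_eq, suffix_succ, (A.graph x).emit_of_le i t ht,
      (A.graph x).receiveTokens_of_le (ht.trans t.le_succ)]
    simp [Emission.token?]

lemma prompt_ne_nil {n : ℕ} (x : Fin n → α) (i : Fin (A.width n)) (t : ℕ) :
    A.prompt x i t ≠ [] := by
  rw [prompt_eq, suffix]
  simp

/-- The prompt of a finished agent no longer changes, so such an agent is settled at no cost. -/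
lemma Implements.next_of_le {T : UHAT (Token Ξ)} {n : ℕ} {x : Fin n → α}
    (h : A.Implements T x) {i : Fin (A.width n)} {t : ℕ} (ht : (A.graph x).len i ≤ t) :
    T.next (A.prompt x i t) = .eos := by
  rw [A.prompt_of_le x ht]
  exact (h i).2.2

lemma len_le_size [Fintype α] {n : ℕ} (x : Fin n → α) (i : Fin (A.width n)) :
    (A.graph x).len i ≤ A.size n :=
  (Finset.single_le_sum (f := (A.graph x).len) (fun _ _ => Nat.zero_le _)
    (Finset.mem_univ i)).trans
    (Finset.le_sup (f := fun x : Fin n → α => (A.graph x).size) (Finset.mem_univ x))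

end MultiAgentSystem

/-! ### Parity and the settling of nodes in time -/

lemma parity_update_ne {n : ℕ} (x : Fin n → Bool) (k : Fin n) :
    parity (Function.update x k true) ≠ parity (Function.update x k false) := by
  have h : (Finset.univ.filter fun l => Function.update x k true l = true)
      = insert k (Finset.univ.filter fun l => Function.update x k false l = true) := by
    ext l
    by_cases hl : l = k
    · subst hl; simp
    · simp [hl]
  have hk : k ∉ Finset.univ.filter fun l => Function.update x k false l = true := by simp
  rw [parity, parity, h, Finset.card_insert_of_notMem hk]
  intro heq
  rw [decide_eq_decide, Nat.odd_add_one] at heq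
  tauto

namespace MultiAgentSystem

variable {Ξ : Type*} (A : MultiAgentSystem Bool Ξ) {T : UHAT (Token Ξ)} {N : ℕ}

/-- On `C`, all tokens generated before time `t` are independent of the input. -/
def Settled (T : UHAT (Token Ξ)) (C : Set (Fin N → Bool)) (t : ℕ) : Prop :=
  ∀ s < t, ∀ i, ConstOn C fun x => T.next (A.prompt x i s)

lemma Settled.graph_eq {A : MultiAgentSystem Bool Ξ} {C : Set (Fin N → Bool)} {t : ℕ}
    (h : A.Settled T C (t + 1)) (hD : A.DrivenBy T N) {x y : Fin N → Bool} (hx : x ∈ C)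
    (hy : y ∈ C) (i : Fin (A.width N)) :
    (∀ s ≤ t, (A.graph x).emit i s = (A.graph y).emit i s) ∧
      (∀ s ≤ t + 1, s < (A.graph x).len i ↔ s < (A.graph y).len i) :=
  hD x y t (fun s hs i => h s (Nat.lt_succ_of_le hs) i x hx y hy) i

/-- A system computing PARITY is not settled as long as an input bit is free. -/
lemma Settled.free_eq_empty {A : MultiAgentSystem Bool Ξ} (hf : A.Computes parity) (hN : 0 < N)
    (hD : A.DrivenBy T N) {C : Subcube (Fin N)} (h : A.Settled T C.points (A.size N + 1)) :
    C.free = ∅ := by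
  by_contra hne
  obtain ⟨k, hk⟩ := Finset.nonempty_iff_ne_empty.2 hne
  have hmem : ∀ b, Function.update C.base k b ∈ C.points := fun b l hl =>
    Function.update_of_ne (fun h : l = k => hl (by rwa [h])) _ _
  refine parity_update_ne C.base k (A.incl.injective
    ((hf N hN (Function.update C.base k true)).unique (hf N hN (Function.update C.base k false))
      fun t => ?_))
  rcases le_or_gt t (A.size N) with ht | ht
  · exact (h.graph_eq hD (hmem true) (hmem false) _).1 t ht
  · rw [(A.graph _).emit_of_le _ t ((A.len_le_size _ _).trans ht.le),
      (A.graph _).emit_of_le _ t ((A.len_le_size _ _).trans ht.le)]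

/-- Following the system in time: if every node can be settled by fixing `c` input bits, then a
system computing PARITY needs many nodes. -/
lemma card_free_le_size (hf : A.Computes parity) (hN : 0 < N)
    (hI : ∀ x : Fin N → Bool, A.Implements T x) (hD : A.DrivenBy T N)
    (Pre : Fin (A.width N) → ℕ → Set (Fin N → Bool) → Prop)
    (hmono : ∀ i t C C', C' ⊆ C → Pre i t C → Pre i t C') {c : ℕ} {C : Subcube (Fin N)}
    (hstep : ∀ i t, ∀ D : Subcube (Fin N), D.points ⊆ C.points → Pre i t D.points →
      ConstOn D.points (fun x => A.suffix x i (t + 1)) →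
      ∃ D' : Subcube (Fin N), D'.Refines D c ∧ Pre i (t + 1) D'.points ∧
        ConstOn D'.points fun x => T.next (A.prompt x i (t + 1)))
    (h0 : A.Settled T C.points 1) (hP0 : ∀ i, Pre i 0 C.points) :
    ∃ x ∈ C.points, C.free.card + c * ∑ i, min ((A.graph x).len i) 1 ≤ c * A.size N := by
  -- The last clause is the ledger: each node at times `1` to `t` has used at most `c` bits. Nodes
  -- at time `0` are credited on the left because `h0` has already settled them.
  have key : ∀ t, ∃ D : Subcube (Fin N), D.points ⊆ C.points ∧ A.Settled T D.points (t + 1) ∧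
      (∀ i, ∀ x ∈ D.points, t < (A.graph x).len i → Pre i t D.points) ∧
      ∀ x ∈ D.points, C.free.card + c * ∑ i, min ((A.graph x).len i) 1 ≤
        D.free.card + c * ∑ i, min ((A.graph x).len i) (t + 1) := by
    intro t
    induction t with
    | zero => exact ⟨C, subset_rfl, h0, fun i _ _ _ => hP0 i, fun x _ => le_rfl⟩
    | succ t ih =>
      obtain ⟨D, hDC, hS, hP, hcard⟩ := ih
      -- Which agents have a node at time `t + 1` is constant on `D`, so `D.base` can decide it.
      -- Only these agents are paid for.
      let alive := Finset.univ.filter fun i => t + 1 < (A.graph D.base).len i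
      obtain ⟨D', hD', hQ⟩ := exists_fix_forall (C := D) (c := c) alive
        (fun i E => Pre i (t + 1) E ∧ ConstOn E fun x => T.next (A.prompt x i (t + 1)))
        (fun i E E' hE h => ⟨hmono i _ E E' hE h.1, h.2.mono hE⟩) (by
          intro i hi E hE
          have hi' : t + 1 < (A.graph D.base).len i := (Finset.mem_filter.1 hi).2
          refine hstep i t E (hE.trans hDC)
            (hmono _ _ _ _ hE (hP i D.base D.base_mem (by omega))) fun x hx y hy => ?_
          exact A.suffix_congr (fun j s hs =>
            (hS.graph_eq hD (hE hx) (hE hy) j).1 s (Nat.lt_succ_iff.1 hs)) i)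
      have halive : ∀ x ∈ D'.points, ∀ i, t + 1 < (A.graph x).len i ↔ i ∈ alive := by
        intro x hx i
        rw [(hS.graph_eq hD (hD'.1 hx) D.base_mem i).2 (t + 1) le_rfl]
        simp [alive]
      refine ⟨D', hD'.1.trans hDC, fun s hs i => ?_, fun i x hx hlt => ?_, fun x hx => ?_⟩
      · rcases (Nat.lt_succ_iff.1 hs).lt_or_eq with hs | rfl
        · exact (hS s hs i).mono hD'.1
        · by_cases hi : i ∈ alive
          · exact (hQ i hi).2
          · have hd : ∀ x ∈ D'.points, T.next (A.prompt x i (t + 1)) = .eos := fun x hx =>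
              (hI x).next_of_le A (not_lt.1 fun h => hi ((halive x hx i).1 h))
            intro x hx y hy
            simp only [hd x hx, hd y hy]
      · exact (hQ i ((halive x hx i).1 hlt)).1
      · have hsum : ∑ i, min ((A.graph x).len i) (t + 1 + 1)
            = ∑ i, min ((A.graph x).len i) (t + 1) + alive.card := by
          rw [Finset.card_eq_sum_ones, ← Finset.sum_filter_add_sum_filter_not Finset.univ
            (fun i => i ∈ alive) (fun i => min ((A.graph x).len i) (t + 1 + 1)),
            ← Finset.sum_filter_add_sum_filter_not Finset.univ
            (fun i => i ∈ alive) (fun i => min ((A.graph x).len i) (t + 1))]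
          have e : Finset.univ.filter (fun i => i ∈ alive) = alive := by ext; simp
          have e1 : ∑ i ∈ alive, min ((A.graph x).len i) (t + 1 + 1)
              = ∑ i ∈ alive, min ((A.graph x).len i) (t + 1) + ∑ i ∈ alive, 1 := by
            rw [← Finset.sum_add_distrib]
            refine Finset.sum_congr rfl fun i hi => ?_
            have := (halive x hx i).2 hi
            omega
          have e2 : ∑ i ∈ Finset.univ.filter (fun i => i ∉ alive),
              min ((A.graph x).len i) (t + 1 + 1) = ∑ i ∈ Finset.univ.filter (fun i => i ∉ alive),
              min ((A.graph x).len i) (t + 1) := by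
            refine Finset.sum_congr rfl fun i hi => ?_
            have := mt (halive x hx i).1 (Finset.mem_filter.1 hi).2
            omega
          rw [e, e1, e2]
          ring
        have h1 := hcard x (hD'.1 hx)
        have h2 := hD'.2
        rw [hsum, mul_add, mul_comm c alive.card]
        omega
  obtain ⟨D, hDC, hS, -, hcard⟩ := key (A.size N)
  refine ⟨D.base, hDC D.base_mem, (hcard D.base D.base_mem).trans ?_⟩
  rw [hS.free_eq_empty hf hN hD, Finset.card_empty, zero_add]
  refine Nat.mul_le_mul_left c ?_
  refine (Finset.sum_le_sum fun i _ => min_le_left _ _).trans ?_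
  exact Finset.le_sup (f := fun x : Fin N → Bool => (A.graph x).size) (Finset.mem_univ D.base)

/-! ### Systems with short chunks -/

lemma junta_chunkTokens (i : Fin (A.width N)) (C : Set (Fin N → Bool)) :
    Junta C (A.chunkLen N i) fun x => A.chunkTokens x i := by
  classical
  refine ⟨Finset.univ.image fun j : Fin (A.chunkLen N i) =>
    ⟨A.chunkStart N i + j, A.chunkStart_add_lt j.2⟩, ?_, fun x _ y _ hxy => ?_⟩
  · exact Finset.card_image_le.trans (by simp)
  · refine List.ext_getElem (by simp only [length_chunkTokens]) fun j h1 h2 => ?_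
    have hj : j < A.chunkLen N i := by rwa [length_chunkTokens] at h1
    rw [A.getElem_chunkTokens x i hj, A.getElem_chunkTokens y i hj,
      hxy _ (Finset.mem_image.2 ⟨⟨j, hj⟩, Finset.mem_univ _, rfl⟩)]

lemma exists_fix_next {i : Fin (A.width N)} {c : ℕ} (hc : A.chunkLen N i ≤ c) {t : ℕ}
    {D : Subcube (Fin N)} (hs : ConstOn D.points fun x => A.suffix x i t) {x : Fin N → Bool}
    (hx : x ∈ D.points) :
    ∃ D' : Subcube (Fin N), D'.Refines D c ∧
      ∀ y ∈ D'.points, T.next (A.prompt y i t) = T.next (A.prompt x i t) := by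
  obtain ⟨D', hD', h⟩ := (A.junta_chunkTokens i D.points).exists_fix hx
  refine ⟨D', hD'.mono hc, fun y hy => ?_⟩
  rw [prompt_eq, prompt_eq, h y hy,
    show A.suffix y i t = A.suffix x i t from hs y (hD'.1 hy) x hx]

/-- Once its suffix is constant, an agent's token depends only on its chunk, so `c` bits settle it.
Time `0` needs care: it is not yet known which agents have a node to charge. -/
lemma le_size_of_chunkLen_le (hf : A.Computes parity) (hN : 0 < N)
    (hI : ∀ x : Fin N → Bool, A.Implements T x) (hD : A.DrivenBy T N) {c : ℕ}
    (hc : ∀ i : Fin (A.width N), A.chunkLen N i ≤ c) : N ≤ c * A.size N := by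
  classical
  have h0 : ∀ s : Finset (Fin (A.width N)), ∃ C : Subcube (Fin N),
      (∀ i ∈ s, ConstOn C.points fun x => T.next (A.prompt x i 0)) ∧
      ∀ x ∈ C.points, N ≤ C.free.card + c * ∑ i ∈ s, min ((A.graph x).len i) 1 := by
    intro s
    induction s using Finset.induction_on with
    | empty => exact ⟨⟨Finset.univ, fun _ => false⟩, by simp, by simp⟩
    | insert a s ha ih =>
      obtain ⟨C, hC, hcard⟩ := ih
      -- If some input yields a token other than `eos`, fixing the chunk accordingly forces a first
      -- node, which pays. Otherwise the token is constantly `eos` and costs nothing.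
      by_cases hex : ∃ x ∈ C.points, T.next (A.prompt x a 0) ≠ .eos
      · obtain ⟨x, hx, hne⟩ := hex
        obtain ⟨C', hC', h⟩ := A.exists_fix_next (T := T) (hc a) (t := 0) (D := C)
          (fun _ _ _ _ => by simp) hx
        refine ⟨C', fun i hi => ?_, fun y hy => ?_⟩
        · rcases Finset.mem_insert.1 hi with rfl | hi
          · exact fun y hy z hz => (h y hy).trans (h z hz).symm
          · exact (hC i hi).mono hC'.1
        · have hlen : 0 < (A.graph y).len a := by
            by_contra hle
            exact hne ((h y hy).symm.trans ((hI y).next_of_le A (not_lt.1 hle)))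
          have h1 := hcard y (hC'.1 hy)
          have h2 := hC'.2
          rw [Finset.sum_insert ha, min_eq_right (show 1 ≤ _ from hlen), mul_add, mul_one]
          omega
      · push Not at hex
        refine ⟨C, fun i hi => ?_, fun y hy => (hcard y hy).trans ?_⟩
        · rcases Finset.mem_insert.1 hi with rfl | hi
          · exact fun y hy z hz => (hex y hy).trans (hex z hz).symm
          · exact hC i hi
        · refine Nat.add_le_add_left (Nat.mul_le_mul_left c ?_) _
          rw [Finset.sum_insert ha]
          exact Nat.le_add_left _ _
  obtain ⟨C, hC, hcard⟩ := h0 Finset.univ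
  obtain ⟨x, hx, h⟩ := A.card_free_le_size hf hN hI hD (fun _ _ _ => True)
    (fun _ _ _ _ _ _ => trivial) (c := c) (C := C)
    (fun i t D _ _ hs => by
      obtain ⟨D', hD', h⟩ := A.exists_fix_next (T := T) (hc i) hs D.base_mem
      exact ⟨D', hD', trivial, fun y hy z hz => (h y hy).trans (h z hz).symm⟩)
    (fun s hs i => by
      obtain rfl : s = 0 := by omega
      exact hC i (Finset.mem_univ i))
    (fun _ => trivial)
  exact (hcard x hx).trans h

/-! ### Systems with long chunks -/

/-- On `C`, the prompt of agent `i` at time `t` has a constant suffix, and all activations at the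
positions of the suffix are constant. -/
def SuffixConst (T : UHAT (Token Ξ)) (i : Fin (A.width N)) (t : ℕ) (C : Set (Fin N → Bool)) :
    Prop :=
  ConstOn C (fun x => A.suffix x i t) ∧
    ∀ q, A.chunkLen N i ≤ q → ∀ x ∈ C, q < (A.prompt x i t).length → ∀ y ∈ C, ∀ k,
      runLayers (T.hardLayers.take k) (T.embStream (A.prompt x i t)) q =
        runLayers (T.hardLayers.take k) (T.embStream (A.prompt y i t)) q

/-- The suffix contains at least the identifier, so the position from which the next token is read
lies in it. -/
lemma SuffixConst.next {A : MultiAgentSystem Bool Ξ} {i : Fin (A.width N)} {t : ℕ}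
    {C : Set (Fin N → Bool)} (h : A.SuffixConst T i t C) :
    ConstOn C fun x => T.next (A.prompt x i t) := by
  intro x hx y hy
  have hlen : (A.prompt x i t).length = (A.prompt y i t).length := by
    rw [length_prompt, length_prompt, show A.suffix x i t = A.suffix y i t from h.1 x hx y hy]
  have hpos : 0 < (A.suffix x i t).length := by simp [suffix]
  have hp := A.length_prompt x i t
  have h1 := h.2 ((A.prompt x i t).length - 1) (by omega) x hx (by omega) y hy T.hardLayers.length
  rw [List.take_length] at h1
  simp only [T.next_eq (A.prompt_ne_nil _ _ _), ← hlen, h1]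

lemma exists_fix_suffix {i : Fin (A.width N)} {t p r c : ℕ} {D : Subcube (Fin N)}
    (hJ : ∀ k, ∀ j < A.chunkLen N i, Junta D.points c fun x =>
      runLayers (T.hardLayers.take k) (T.embStream (A.chunkTokens x i)) j)
    (hs : ConstOn D.points fun x => A.suffix x i t) (hp : A.chunkLen N i ≤ p)
    (hpr : ∀ x ∈ D.points, (A.prompt x i t).length ≤ p + r)
    (hrow : ∀ q, A.chunkLen N i ≤ q → q < p → ∀ k, ConstOn D.points fun x =>
      runLayers (T.hardLayers.take k) (T.embStream (A.prompt x i t)) q) :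
    ∃ D' : Subcube (Fin N), D'.Refines D (r * (T.depth * (T.heads * c))) ∧
      A.SuffixConst T i t D'.points := by
  obtain ⟨D', hD', h⟩ := exists_fix_positions T.hardLayers (C := D)
    (X := fun x => T.embStream (A.prompt x i t)) (p := p) (c := c)
    (fun k j hj => by
      rcases lt_or_ge j (A.chunkLen N i) with hlt | hge
      · refine (hJ k j hlt).congr fun x _ => ?_
        rw [prompt_eq, T.runLayers_embStream_append _ _ _ (by rwa [length_chunkTokens])]
      · exact (hrow j hge hj k).junta c)
    -- The block may extend past the end of the prompt; the stream is zero there, so the input row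
    -- is constant in this case too.
    r (fun q h1 _ x hx y hy => by
      simp only [T.embStream_eq, prompt_eq]
      rw [List.getElem?_append_right (by rw [length_chunkTokens]; omega),
        List.getElem?_append_right (by rw [length_chunkTokens]; omega),
        length_chunkTokens, length_chunkTokens,
        show A.suffix x i t = A.suffix y i t from hs x hx y hy])
  refine ⟨D', ?_, hs.mono hD'.1, fun q hq x hx hlt y hy k => ?_⟩
  · simpa [UHAT.hardLayers, UHAT.depth] using hD'
  · rcases lt_or_ge q p with hqp | hqp
    · exact hrow q hq hqp k x (hD'.1 hx) y (hD'.1 hy)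
    · exact h q hqp (hlt.trans_le (hpr x (hD'.1 hx))) k x hx y hy

/-- The positions of all chunks. -/
noncomputable def chunkPositions (N : ℕ) : Finset (Fin (A.width N) × ℕ) :=
  (Finset.univ ×ˢ Finset.range N).filter fun z => z.2 < A.chunkLen N z.1

lemma mem_chunkPositions {i : Fin (A.width N)} {j : ℕ} :
    (i, j) ∈ A.chunkPositions N ↔ j < A.chunkLen N i := by
  refine ⟨fun h => (Finset.mem_filter.1 h).2, fun h => Finset.mem_filter.2 ⟨?_, h⟩⟩
  have := A.chunkStart_add_lt h
  simp only [Finset.mem_product, Finset.mem_univ, Finset.mem_range, true_and]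
  omega

/-- Chunks are disjoint intervals of the input, so local positions inject into global ones. -/
lemma card_chunkPositions_le : (A.chunkPositions N).card ≤ N := by
  have hlt : ∀ (i i' : Fin (A.width N)) (j : ℕ), j < A.chunkLen N i → i < i' →
      A.chunkStart N i + j < A.chunkStart N i' := fun i i' j hj hi => by
    have := A.chunkStart_mono N (show (i : ℕ) + 1 ≤ i' from hi)
    rw [chunkLen] at hj
    omega
  refine (Finset.card_le_card_of_injOn (t := Finset.range N)
    (fun z => A.chunkStart N z.1 + z.2) ?_ ?_).trans (by simp)
  · rintro ⟨i, j⟩ h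
    simpa using A.chunkStart_add_lt (A.mem_chunkPositions.1 h)
  · rintro ⟨i, j⟩ h ⟨i', j'⟩ h' heq
    have h1 := A.mem_chunkPositions.1 h
    have h2 := A.mem_chunkPositions.1 h'
    simp only at heq
    rcases lt_trichotomy i i' with hi | rfl | hi
    · have := hlt i i' j h1 hi
      omega
    · rw [Nat.add_left_cancel heq]
    · have := hlt i' i j' h2 hi
      omega

lemma junta_embStream_chunkTokens {i : Fin (A.width N)} {j : ℕ} (hj : j < A.chunkLen N i)
    (C : Set (Fin N → Bool)) : Junta C 1 fun x => T.embStream (A.chunkTokens x i) j := by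
  refine ⟨{⟨A.chunkStart N i + j, A.chunkStart_add_lt hj⟩}, by simp, fun x _ y _ hxy => ?_⟩
  have h1 : ∀ x : Fin N → Bool, j < (A.chunkTokens x i).length := fun x => by
    rwa [length_chunkTokens]
  simp only [T.embStream_eq, List.getElem?_eq_getElem (h1 _), A.getElem_chunkTokens _ i hj,
    hxy _ (Finset.mem_singleton_self _)]

/-- Junta size of the activations at the chunk positions. -/
def chunkBound (H L : ℕ) : ℕ := (layerBound H (2 * (L + 1)))^[L] 1

/-- Cost of settling one node. -/
def nodeCost (H L : ℕ) : ℕ := 2 * (L * (H * chunkBound H L))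

/-- Budget: at most `N / 2` bits go into the junta restriction and at most `N / 4` into the first
tokens of all agents. The remaining `N / 4` or more must be paid for by nodes at cost `n₀` each. -/
lemma le_size_of_width_le (hf : A.Computes parity) (hN : 0 < N)
    (hI : ∀ x : Fin N → Bool, A.Implements T x) (hD : A.DrivenBy T N) {H L : ℕ} (hH0 : 0 < H)
    (hH : T.heads ≤ H) (hL : T.depth ≤ L) (hw : A.width N * (4 * nodeCost H L) ≤ N) :
    N ≤ 4 * nodeCost H L * A.size N := by
  set c := chunkBound H L with hc
  set n₀ := nodeCost H L with hn₀
  have hlen : T.hardLayers.length = T.depth := by simp [UHAT.hardLayers, UHAT.depth]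
  have hcost : ∀ r ≤ 2, r * (T.depth * (T.heads * c)) ≤ n₀ := fun r hr =>
    Nat.mul_le_mul hr (Nat.mul_le_mul hL (Nat.mul_le_mul_right c hH))
  obtain ⟨C₀, s, hC₀, hs, hJ⟩ := exists_refines_junta_runLayers T.hardLayers (H := H)
    (m := 2 * (L + 1)) (c := 1) (N := N) (by simpa using hH) hH0 (by omega) one_pos
    (A.chunkPositions N)
    (fun i j k hj hk => A.mem_chunkPositions.2 (hk.trans_lt (A.mem_chunkPositions.1 hj)))
    A.card_chunkPositions_le (C := ⟨Finset.univ, fun _ => false⟩)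
    (X := fun x i => T.embStream (A.chunkTokens x i))
    (fun i j hij => A.junta_embStream_chunkTokens (A.mem_chunkPositions.1 hij) _)
  -- Each layer costs at most `N / (2 * (L + 1))` bits, and there are at most `L` layers.
  have hs2 : 2 * s ≤ N := by
    have h1 : s * (2 * (L + 1)) ≤ (L + 1) * N :=
      hs.trans (Nat.mul_le_mul_right N (by omega))
    have h2 : (L + 1) * (2 * s) ≤ (L + 1) * N := by linarith
    exact Nat.le_of_mul_le_mul_left h2 (by omega)
  have hJ' : ∀ (i : Fin (A.width N)) (k : ℕ), ∀ j < A.chunkLen N i, Junta C₀.points c fun x =>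
      runLayers (T.hardLayers.take k) (T.embStream (A.chunkTokens x i)) j := fun i k j hj =>
    (hJ k i j (A.mem_chunkPositions.2 hj)).mono subset_rfl
      (Function.monotone_iterate_of_id_le (le_layerBound H _) (hlen.trans_le hL) 1)
  have hmono : ∀ i t (C C' : Set (Fin N → Bool)), C' ⊆ C → A.SuffixConst T i t C → A.SuffixConst T i t C' :=
    fun i t C C' hC h => ⟨h.1.mono hC, fun q hq x hx hlt y hy => h.2 q hq x (hC hx) hlt y (hC hy)⟩
  obtain ⟨C₁, hC₁, hP₁⟩ := exists_fix_forall (C := C₀) (c := n₀) Finset.univ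
    (fun i E => A.SuffixConst T i 0 E) (fun i => hmono i 0) (fun i _ D hDC => by
      obtain ⟨D', hD', h⟩ := A.exists_fix_suffix (T := T) (i := i) (t := 0)
        (p := A.chunkLen N i) (r := 1) (c := c) (D := D)
        (fun k j hj => (hJ' i k j hj).mono hDC le_rfl) (fun _ _ _ _ => by simp) le_rfl
        (fun x _ => by simp [length_prompt]) (fun q h1 h2 => by omega)
      exact ⟨D', hD'.mono (hcost 1 (by norm_num)), h⟩)
  obtain ⟨x, -, h⟩ := A.card_free_le_size hf hN hI hD (A.SuffixConst T) hmono (c := n₀) (C := C₁)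
    (fun i t D hDC hP hsuf => by
      obtain ⟨D', hD', h⟩ := A.exists_fix_suffix (T := T) (i := i) (t := t + 1)
        (p := (A.prompt D.base i t).length) (r := 2) (c := c) (D := D)
        (fun k j hj => (hJ' i k j hj).mono (hDC.trans hC₁.1) le_rfl) hsuf
        (by rw [length_prompt]; omega)
        (fun x hx => by
          have := A.length_suffix_succ_le x i t
          have heq : A.suffix x i t = A.suffix D.base i t := hP.1 x hx _ D.base_mem
          rw [length_prompt, length_prompt, ← heq]
          omega)
        (fun q h1 h2 k x hx y hy => by
          have hl : ∀ z ∈ D.points, q < (A.prompt z i t).length := fun z hz => by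
            rw [length_prompt, show A.suffix z i t = A.suffix D.base i t from hP.1 z hz _ D.base_mem,
              ← length_prompt]
            exact h2
          obtain ⟨u, hu⟩ := A.prompt_succ x i t
          obtain ⟨v, hv⟩ := A.prompt_succ y i t
          simp only [hu, hv]
          rw [T.runLayers_embStream_append _ _ _ (hl x hx),
            T.runLayers_embStream_append _ _ _ (hl y hy)]
          exact hP.2 q h1 x hx (hl x hx) y hy k)
      exact ⟨D', hD'.mono (hcost 2 le_rfl), h, h.next⟩)
    (fun s hs i => by
      obtain rfl : s = 0 := by omega
      exact (hP₁ i (Finset.mem_univ i)).next)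
    (fun i => hP₁ i (Finset.mem_univ i))
  have h1 := hC₀.2
  have h2 := hC₁.2
  simp only [Finset.card_univ, Fintype.card_fin] at h1 h2
  have h3 : 4 * (A.width N * n₀) ≤ N := by linarith
  have h4 : 4 * n₀ * A.size N = 4 * (n₀ * A.size N) := by ring
  have h5 : C₁.free.card ≤ n₀ * A.size N := (Nat.le_add_right _ _).trans h
  omega

end MultiAgentSystem

end MAS

/-! ### The linear lower bound -/

open MAS
theorem mainTheorem4 {Ξ : Type*} (A : MultiAgentSystem Bool Ξ) (hA : A.Expressible)
    (hf : A.Computes parity) :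
    (fun N : ℕ => (N : ℝ)) =O[atTop] (fun N : ℕ => (A.size N : ℝ)) := by
  obtain ⟨H, L, hT⟩ := hA
  -- `H + 1` keeps the head bound positive. The same `K` separates short from long chunks and is the
  -- final constant in both cases.
  set K := 4 * MultiAgentSystem.nodeCost (H + 1) L with hK
  refine IsBigO.of_bound (K : ℝ) ?_
  filter_upwards [eventually_gt_atTop 0] with N hN
  obtain ⟨T, hH, hL, hrun⟩ := hT N
  obtain ⟨hI, hD⟩ := hrun N hN le_rfl
  have key : N ≤ K * A.size N := by
    rcases le_total (A.width N * K) N with hw | hw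
    · exact A.le_size_of_width_le hf hN hI hD H.succ_pos (hH.trans H.le_succ) hL hw
    · exact A.le_size_of_chunkLen_le hf hN hI hD fun i => A.chunkLen_le hw i
  rw [Real.norm_natCast, Real.norm_natCast]
  exact_mod_cast key
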